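/- Let $d,\alpha\in\mathbb N=\{1,2,\dots\}$, let $\gamma>0$, let $\mathbb A$ be a Borel space (measurably isomorphic to a measurable subset of $[0,1]$) and $\Theta$ a probability measure on $\mathbb A$. For $1\le j\le\alpha$ let $\varphi_j:(\mathbb R^d\times\mathbb A)^{j+1}\to[0,1]$ be measurable, symmetric, and invariant under simultaneous translation of the $\mathbb R^d$-components of its arguments. *The random complex.* Let $\mathbb M=\prod_{j=1}^{\alpha}[0,1]^{(\mathbb N_0\times\mathbb N_0)^{j}}$ and let $\mathbb Q$ be the product of the uniform distributions on $[0,1]$. Let $\Psi$ be a Poisson process on $\mathbb R^d\times\mathbb A\times[0,1]\times\mathbb M$ with intensity measure $\gamma\lambda_d\otimes\Theta\otimes\mathcal U([0,1])\otimes\mathbb Q$, all of whose realisations are locally finite counting measures (finite on $B\times\mathbb A\times[0,1]\times\mathbb M$ for bounded $B$). Fix an enumeration $z_0=\mathbf 0,z_1,z_2,\dots$ of $\mathbb Z^d$. For a locally finite counting measure $\psi$ on $\mathbb R^d\times\mathbb A\times[0,1]\times\mathbb M$, a point $(x,a,t,u)$ of $\psi$ has coordinates $(k,i)$ if $x\in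 Q_k:=[0,1)^d+z_k$ and it is the $i$-th smallest, with respect to the component $t$, among the points of $\psi$ in $Q_k\times\mathbb A\times[0,1]\times\mathbb M$. For points $(x_0,a_0,t_0,u^{(0)}),\dots,(x_j,a_j,t_j,u^{(j)})$ of $\psi$ with $t_0<\dots<t_j$, $1\le j\le\alpha$, and $\rho=\{(x_0,a_0),\dots,(x_j,a_j)\}$, let $u(\rho)$ be the component of $u^{(j)}$ indexed by the coordinates of the first $j$ of these points. Let $T(\psi)$ be the simplicial complex whose vertices are the pairs $(x,a)$ belonging to points of $\psi$, and in which a nonempty set $\sigma$ of at most $\alpha+1$ vertices is a simplex if and only if $u(\rho)\le\varphi_{|\rho|-1}(\rho)$ for all $\rho\subseteq\sigma$ with $|\rho|\ge2$. (Almost surely the points of $\Psi$ have distinct components $x$ and distinct components $t$.) For $W\subseteq\mathbb R^d$ and a complex $K$ with vertices in $\mathbb R^d\times\mathbb A$, let $K_W$ be its subcomplex of simplices with all vertices in $W\times\mathbb A$. *The difference operator.* Let $V\sim\Theta$ and $U\sim\mathbb Q$ be such that $V,U,\Psi$ are independent, and put $\Delta^{\mathbf 0}:=T(\Psi+\delta_{(\mathbf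 0,V,1,U)})$. For a real function $f$ of finite simplicial complexes with vertices in $\mathbb R^d\times\mathbb A$ and a bounded measurable $W\subseteq\mathbb R^d$ let $$\Lambda f(W):=f\big(\Delta^{\mathbf 0}_{W}\big)-f\big(\Delta^{\mathbf 0}_{W\setminus\{\mathbf 0\}}\big).$$ A cube is a set $\prod_{i=1}^d[c_i,c_i+s)$ with $c\in\mathbb R^d$, $s>0$; for cubes $W_n$ we write $W_n\to\mathbb R^d$ if every bounded set is contained in $W_n$ for all sufficiently large $n$. * $f$ is *weakly stabilizing* if $f(K)=f(K+t)$ for all finite complexes $K$ with vertices in $\mathbb R^d\times\mathbb A$ and all $t\in\mathbb R^d$ (translation of the $\mathbb R^d$-components of the vertices), $\Lambda f(W)$ is a random variable (measurable up to a null set) for every cube $W$, and there is a real-valued random variable $Z$ such that $\Lambda f(W_n)\to Z$ in probability for every sequence of cubes $W_n\to\mathbb R^d$. * $f$ satisfies the *moment condition* if, with $\Lambda f(W)$ measurable up to a null set for every cube $W\ni\mathbf 0$, there is $\varepsilon>0$ with $\sup\mathbb E\,|\Lambda f(W)|^{2+\varepsilon}<\infty$, the supremum being over all cubes $W$ with $\mathbf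 0\in W$. *The functional.* For $m\in\mathbb N$ and a vertex $v$ of a finite simplicial complex $K$ let $\deg_m(v,K)$ be the number of simplices of $K$ that contain $v$ and have exactly $m+1$ elements. For $l\in\mathbb N_0$ let $d_m^l(K)$ be the number of vertices $v$ of $K$ with $\deg_m(v,K)=l$. **Corollary.** Let $m\in\mathbb N$, $l\in\mathbb N_0$, and let $$\pi(a):=\gamma\int_{\mathbb R^d}\int_{\mathbb A}\varphi_1\big((\mathbf 0,a),(y,b)\big)\,\Theta(\mathrm db)\,\mathrm dy\in[0,\infty],\qquad a\in\mathbb A.$$ If $\mathbb E[\pi(V)^3]<\infty$, then $d_m^l$ is weakly stabilizing and satisfies the moment condition. -/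

import Mathlib

open MeasureTheory ProbabilityTheory Filter Topology
open scoped ENNReal NNReal

noncomputable section

namespace RCM

/-! ### Simplicial complexes

`PreAbstractSimplicialComplex ι` is a downward closed family of nonempty finite subsets of `ι`;
its vertices are its `0`-simplices. -/

section Complexes

variable {ι : Type*}

/-- The vertices (that is, the `0`-simplices) of a simplicial complex. -/
def vertices (K : PreAbstractSimplicialComplex ι) : Set ι := {v | {v} ∈ K.faces}

/-- The `n`-simplex degree of `v` in `K`: the number of `n`-simplices of `K` that contain `v`. -/
def simplexDegree (n : ℕ) (v : ι) (K : PreAbstractSimplicialComplex ι) : ℕ :=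
  {σ : Finset ι | σ ∈ K.faces ∧ v ∈ σ ∧ σ.card = n + 1}.ncard

/-- The number of vertices of `K` whose `m`-simplex degree is equal to `l`. -/
def numVerticesOfDegree (m l : ℕ) (K : PreAbstractSimplicialComplex ι) : ℝ :=
  ({v : ι | v ∈ vertices K ∧ simplexDegree m v K = l}.ncard : ℝ)

end Complexes

/-! ### Poisson processes on `ℝᵈ × S` -/

/-- Euclidean space `ℝᵈ`. -/
abbrev Space (d : ℕ) : Type := EuclideanSpace ℝ (Fin d)

section Poisson

variable {d : ℕ} {S Ω : Type*} [MeasurableSpace S] [MeasurableSpace Ω]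

/-- Locally finite counting measures on `ℝᵈ × S`: the values are natural numbers or `∞`, and
`η (B × S) < ∞` for all bounded measurable `B`. -/
structure IsLocallyFiniteCounting (η : Measure (Space d × S)) : Prop where
  counting : ∀ B, MeasurableSet B → η B = ∞ ∨ ∃ n : ℕ, η B = n
  locallyFinite : ∀ B : Set (Space d), MeasurableSet B → Bornology.IsBounded B →
    η (B ×ˢ Set.univ) < ∞

/-- The Poisson distribution with parameter in `[0, ∞]`; for the parameter `∞` it is the point mass
at `∞`. -/
def poissonLaw (r : ℝ≥0∞) : Measure ℝ≥0∞ :=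
  if r = ∞ then Measure.dirac ∞
  else (poissonMeasure r.toNNReal).map (fun n : ℕ => (n : ℝ≥0∞))

/-- `Ψ` is a Poisson process on `ℝᵈ × S` with intensity measure `μ`. -/
structure IsPoissonProcess (P : Measure Ω) (Ψ : Ω → Measure (Space d × S))
    (μ : Measure (Space d × S)) : Prop where
  measurable : Measurable Ψ
  locallyFiniteCounting : ∀ ω, IsLocallyFiniteCounting (Ψ ω)
  law : ∀ B, MeasurableSet B → P.map (fun ω => Ψ ω B) = poissonLaw (μ B)
  indep : ∀ (k : ℕ) (B : Fin k → Set (Space d × S)), (∀ i, MeasurableSet (B i)) →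
    Pairwise (fun i j => Disjoint (B i) (B j)) → iIndepFun (fun i ω => Ψ ω (B i)) P

end Poisson

/-! ### The random simplicial complex -/

/-- A connection function `φ_j` on `(ℝᵈ × A)^(j+1)`: measurable, with values in `[0,1]`, symmetric
and invariant under simultaneous translation of the Euclidean components. -/
structure IsConnectionFunction {d : ℕ} {A : Type*} [MeasurableSpace A] {j : ℕ}
    (φ : (Fin (j + 1) → Space d × A) → ℝ) : Prop where
  measurable : Measurable φ
  mem_unit : ∀ p, φ p ∈ Set.Icc (0 : ℝ) 1
  symm : ∀ (s : Equiv.Perm (Fin (j + 1))) p, φ (fun i => p (s i)) = φ p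
  translation : ∀ (t : Space d) p, φ (fun i => ((p i).1 + t, (p i).2)) = φ p

/-- Indices of the components of an element of the decision space: a dimension `j ∈ {1, …, α}`
together with `j` pairs of natural numbers (the coordinates of `j` points). -/
abbrev DecisionIndex (α : ℕ) : Type := Σ j : Set.Icc 1 α, (Fin (j : ℕ) → ℕ × ℕ)

/-- The space `𝕄 = M⁽²⁾ × ⋯ × M⁽²ᵅ⁾` of families of numbers in `[0,1]`. -/
abbrev Decision (α : ℕ) : Type := DecisionIndex α → unitInterval

/-- The distribution `ℚ` on `𝕄`: all components are independent and uniform on `[0,1]`. -/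
def decisionLaw (α : ℕ) : Measure (Decision α) :=
  Measure.infinitePi (fun _ : DecisionIndex α => (volume : Measure unitInterval))

/-- Points `(x, a, t, u)` of `ℝᵈ × A × [0,1] × 𝕄`. -/
abbrev MarkedPoint (d : ℕ) (A : Type*) (α : ℕ) : Type _ := Space d × A × unitInterval × Decision α

section Construction

variable {d : ℕ} {A : Type*} {α : ℕ}

/-- The vertex `(x, a)` belonging to `(x, a, t, u)`. -/
def MarkedPoint.vertex (p : MarkedPoint d A α) : Space d × A := (p.1, p.2.1)

/-- The ordering component `t` of `(x, a, t, u)`. -/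
def MarkedPoint.time (p : MarkedPoint d A α) : unitInterval := p.2.2.1

/-- The decision component `u` of `(x, a, t, u)`. -/
def MarkedPoint.decision (p : MarkedPoint d A α) : Decision α := p.2.2.2

/-- Given an enumeration `z` of `ℤᵈ`, the number `k` of the cube `[0,1)ᵈ + z k` that contains
`x`. -/
def cubeIndex (z : ℕ ≃ (Fin d → ℤ)) (x : Space d) : ℕ := z.symm (fun i => ⌊x i⌋)

variable [MeasurableSpace A]

/-- The points of a counting measure. -/
def points (ψ : Measure (MarkedPoint d A α)) : Set (MarkedPoint d A α) := {p | ψ {p} ≠ 0}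

/-- The coordinates `(k, i)` of `p` in `ψ`: `p` lies in the cube number `k` and is there the `i`-th
smallest point of `ψ` with respect to the ordering component. -/
def coordinates (z : ℕ ≃ (Fin d → ℤ)) (ψ : Measure (MarkedPoint d A α))
    (p : MarkedPoint d A α) : ℕ × ℕ :=
  (cubeIndex z p.1,
    {q | q ∈ points ψ ∧ cubeIndex z q.1 = cubeIndex z p.1 ∧ q.time ≤ p.time}.ncard)

/-- For points `p 0, …, p j` of `ψ`, in increasing order, the number in `[0,1]` that decides about
the simplex spanned by them: the component of the decision variable of the last point that is
indexed by the coordinates of the other points. -/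
def decisionValue (z : ℕ ≃ (Fin d → ℤ)) (ψ : Measure (MarkedPoint d A α)) (j : Set.Icc 1 α)
    (p : Fin ((j : ℕ) + 1) → MarkedPoint d A α) : unitInterval :=
  (p (Fin.last (j : ℕ))).decision ⟨j, fun i => coordinates z ψ (p i.castSucc)⟩

/-- The simplicial complex `T(ψ)` with vertices in `ℝᵈ × A`. A simplex is a set `σ` of at most
`α + 1` vertices such that `u(ρ) ≤ φ_j(ρ)` for all `ρ ⊆ σ` with `j + 1 ≥ 2` elements; here `ρ` is
listed as `p 0, …, p j` in increasing order of the ordering components. -/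
def complex (z : ℕ ≃ (Fin d → ℤ)) (φ : (j : ℕ) → (Fin (j + 1) → Space d × A) → ℝ)
    (ψ : Measure (MarkedPoint d A α)) : PreAbstractSimplicialComplex (Space d × A) where
  faces := {σ | σ.Nonempty ∧ σ.card ≤ α + 1 ∧ (∀ v ∈ σ, ∃ p ∈ points ψ, p.vertex = v) ∧
    ∀ (j : Set.Icc 1 α) (p : Fin ((j : ℕ) + 1) → MarkedPoint d A α),
      (∀ i, p i ∈ points ψ) → (∀ i, (p i).vertex ∈ σ) → StrictMono (fun i => (p i).time) →
      (decisionValue z ψ j p : ℝ) ≤ φ j (fun i => (p i).vertex)}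
  isRelLowerSet_faces := by
    rintro σ ⟨h0, h1, h2, h3⟩
    refine ⟨h0, fun τ hτ hne => ⟨hne, (Finset.card_le_card hτ).trans h1, fun v hv => h2 v (hτ hv),
      fun j p hp hv ht => h3 j p hp (fun i => hτ (hv i)) ht⟩⟩

/-- The restriction of a complex to the simplices with all vertices in `W × A`. -/
def restrictTo (K : PreAbstractSimplicialComplex (Space d × A)) (W : Set (Space d)) :
    PreAbstractSimplicialComplex (Space d × A) where
  faces := {σ | σ ∈ K.faces ∧ ∀ v ∈ σ, v.1 ∈ W}
  isRelLowerSet_faces := by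
    rintro σ ⟨h0, h1⟩
    exact ⟨(K.isRelLowerSet_faces h0).1, fun τ hτ hne =>
      ⟨(K.isRelLowerSet_faces h0).2 hτ hne, fun v hv => h1 v (hτ hv)⟩⟩

/-- The difference operator
`Λ_p f(Δ_W) = f(T(ψ + δ_p)_W) - f(T(ψ + δ_p)_{W \ {x}})` for `p = (x, a, t, u)`. -/
def diffOp (z : ℕ ≃ (Fin d → ℤ)) (φ : (j : ℕ) → (Fin (j + 1) → Space d × A) → ℝ)
    (f : PreAbstractSimplicialComplex (Space d × A) → ℝ) (W : Set (Space d))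
    (p : MarkedPoint d A α) (ψ : Measure (MarkedPoint d A α)) : ℝ :=
  f (restrictTo (complex z φ (ψ + Measure.dirac p)) W) -
    f (restrictTo (complex z φ (ψ + Measure.dirac p)) (W \ {p.1}))

/-- The intensity measure `γ λ_d ⊗ Θ ⊗ U([0,1]) ⊗ ℚ`. -/
def intensity (d α : ℕ) (γ : ℝ≥0) (Θ : Measure A) : Measure (MarkedPoint d A α) :=
  (γ • (volume : Measure (Space d))).prod
    (Θ.prod ((volume : Measure unitInterval).prod (decisionLaw α)))

/-- The mixing parameter `π(a) = γ ∫ ∫ φ₁((0,a),(y,b)) Θ(db) dy`, with values in `[0, ∞]`. -/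
def mixingParameter (γ : ℝ≥0) (Θ : Measure A)
    (φ : (j : ℕ) → (Fin (j + 1) → Space d × A) → ℝ) (a : A) : ℝ≥0∞ :=
  γ * ∫⁻ y : Space d, ∫⁻ b : A, ENNReal.ofReal (φ 1 ![((0 : Space d), a), (y, b)]) ∂Θ

end Construction

/-! ### Weak stabilization and the moment condition -/

/-- Half-open cubes in `ℝᵈ`. -/
def IsCube {d : ℕ} (W : Set (Space d)) : Prop :=
  ∃ (c : Fin d → ℝ) (s : ℝ), 0 < s ∧ W = {x : Space d | ∀ i, c i ≤ x i ∧ x i < c i + s}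

/-- `W_n → ℝᵈ`: every bounded set is eventually contained in `W_n`. -/
def TendsToSpace {d : ℕ} (W : ℕ → Set (Space d)) : Prop :=
  ∀ B : Set (Space d), Bornology.IsBounded B → ∃ N, ∀ n ≥ N, B ⊆ W n

open Classical in
/-- `f K = f (K + t)` for all finite complexes `K` with vertices in `ℝᵈ × A` and all `t ∈ ℝᵈ`. -/
def IsTranslationInvariant {d : ℕ} {A : Type*}
    (f : PreAbstractSimplicialComplex (Space d × A) → ℝ) : Prop :=
  ∀ (K : PreAbstractSimplicialComplex (Space d × A)) (t : Space d), K.faces.Finite →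
    f K = f (K.map (fun v : Space d × A => (v.1 + t, v.2)))

section Stabilization

variable {d : ℕ} {A Ω : Type*} {α : ℕ} [MeasurableSpace A] [MeasurableSpace Ω]

/-- The operator `Λ_{(0,V,1,U)} f(Δ_W)` as a function on the probability space. -/
def originDiffOp (z : ℕ ≃ (Fin d → ℤ)) (φ : (j : ℕ) → (Fin (j + 1) → Space d × A) → ℝ)
    (Ψ : Ω → Measure (MarkedPoint d A α)) (V : Ω → A) (U : Ω → Decision α)
    (f : PreAbstractSimplicialComplex (Space d × A) → ℝ) (W : Set (Space d)) (ω : Ω) : ℝ :=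
  diffOp z φ f W ((0 : Space d), V ω, (1 : unitInterval), U ω) (Ψ ω)

/-- `f` is weakly stabilizing: it is translation-invariant, and there is a real random variable `Z`
to which the random variables `Λ_{(0,V,1,U)} f(Δ_{W_n})` converge in probability, for all sequences
of cubes `W_n → ℝᵈ`. Only the values of `f` on finite complexes matter. -/
def IsWeaklyStabilizing (P : Measure Ω) (z : ℕ ≃ (Fin d → ℤ))
    (φ : (j : ℕ) → (Fin (j + 1) → Space d × A) → ℝ)
    (Ψ : Ω → Measure (MarkedPoint d A α)) (V : Ω → A) (U : Ω → Decision α)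
    (f : PreAbstractSimplicialComplex (Space d × A) → ℝ) : Prop :=
  IsTranslationInvariant f ∧
  (∀ W : Set (Space d), IsCube W → AEMeasurable (originDiffOp z φ Ψ V U f W) P) ∧
  ∃ Z : Ω → ℝ, Measurable Z ∧
    ∀ W : ℕ → Set (Space d), (∀ n, IsCube (W n)) → TendsToSpace W →
      TendstoInMeasure P (fun n => originDiffOp z φ Ψ V U f (W n)) atTop Z

/-- The moment condition: for some `ε > 0`, the supremum of `E |Λ_{(0,V,1,U)} f(Δ_W)|^(2+ε)` over
all cubes `W` that contain the origin is finite. -/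
def MomentCondition (P : Measure Ω) (z : ℕ ≃ (Fin d → ℤ))
    (φ : (j : ℕ) → (Fin (j + 1) → Space d × A) → ℝ)
    (Ψ : Ω → Measure (MarkedPoint d A α)) (V : Ω → A) (U : Ω → Decision α)
    (f : PreAbstractSimplicialComplex (Space d × A) → ℝ) : Prop :=
  (∀ W : Set (Space d), IsCube W → 0 ∈ W → AEMeasurable (originDiffOp z φ Ψ V U f W) P) ∧
  ∃ ε : ℝ, 0 < ε ∧
    ⨆ (W : Set (Space d)) (_ : IsCube W) (_ : 0 ∈ W),
      ∫⁻ ω, ‖originDiffOp z φ Ψ V U f W ω‖ₑ ^ (2 + ε) ∂P < ∞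

end Stabilization

end RCM

end

set_option linter.unusedSectionVars false

noncomputable section

namespace RCM


/-! Write o for the added vertex. Deleting o changes the `m`-simplex degree of another vertex only
if some simplex contains both. Hence the difference operator involves only o and its neighbours
(`numVertices_sub_eq`), and its absolute value is at most one plus the number of neighbours in `W`.

A neighbour of o must satisfy the edge condition with o. Since o has the largest ordering component,
that edge is decided by the component of `U` indexed by the coordinates of the other point
(`IsAddable.neighbors_subset`). Distinct points have distinct coordinates, so for a fixed
configuration and mark the number of connected points is a sum of independent indicators. Its
exponential moment at `s` is at most exp((e^s - 1) X), where X integrates the edge probability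
against the configuration (`IsSimple.lintegral_exp_connectedSet_le`). The exponential moment of X is
in turn controlled by its mean (`IsPoissonProcess.lintegral_exp_le`), which is at most π(a). With s
= 1 / max(1, π(a)) the resulting exponent is bounded by an absolute constant, and t³ ≤ 6 e^t yields
a third moment of order 1 + π(a)³, uniformly in `W` (`lintegral_connectedSet_pow_le`). Integrating
over the mark gives the moment condition with exponent 2 + 1.

The same bound on growing balls and monotone convergence show that o almost surely has only finitely
many neighbours in the whole space. For each fixed vertex, having degree `l` in the restriction to
`W` is eventually decided as `W` grows: either all its finitely many simplices are present, or more
than `l` of them are. As only finitely many vertices matter, the difference is eventually constant,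
with the same constant for all sequences of cubes (`exists_numVertices_sub_stable`).

Measurability is a separate matter, because the complex is defined through cardinalities. Almost
surely the configuration is simple (`ae_isSimple`), and then the cardinalities are integrals against
the configuration (`IsSimple.numVertices_eq`), which depend measurably on it. -/

/-! ### Counting measures -/

/-- A measure with integer values has an atom in every set of finite positive measure. -/
theorem exists_atom {X : Type*} [MeasurableSpace X] [StandardBorelSpace X] {η : Measure X}
    (h : ∀ B, MeasurableSet B → η B = ∞ ∨ ∃ n : ℕ, η B = n) {B : Set X} (hB : MeasurableSet B)
    (h0 : η B ≠ 0) (hfin : η B ≠ ∞) : ∃ p ∈ B, η {p} ≠ 0 := by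
  classical
  -- Choose `C` inside `B` with the least nonzero mass. Then every measurable set either misses `C`
  -- or contains it up to a null set, so the restriction to `C` is a two-valued measure on a
  -- countably separated space and is concentrated in one point.
  have hex : ∃ n : ℕ, n ≠ 0 ∧ ∃ C ⊆ B, MeasurableSet C ∧ η C = n := by
    rcases h B hB with h' | ⟨n, hn⟩
    · exact absurd h' hfin
    · exact ⟨n, fun h => h0 (by simp [hn, h]), B, subset_rfl, hB, hn⟩
  obtain ⟨hn0, C, hCB, hC, hCn⟩ := Nat.find_spec hex
  set n := Nat.find hex with hn
  have hmin : ∀ D, MeasurableSet D → η (C ∩ D) = 0 ∨ n ≤ η (C ∩ D) := by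
    intro D hD
    rcases h (C ∩ D) (hC.inter hD) with h' | ⟨k, hk⟩
    · right; simp [h']
    · by_cases hk0 : k = 0
      · left; simp [hk, hk0]
      · right
        rw [hk]
        exact_mod_cast Nat.find_min' hex
          ⟨hk0, C ∩ D, Set.inter_subset_left.trans hCB, hC.inter hD, hk⟩
  have hCpos : (n : ℝ≥0∞) ≠ 0 := by exact_mod_cast hn0
  have hne : (η.restrict C) ≠ 0 := by
    intro h'
    apply hCpos
    rw [← hCn]
    simpa using h'
  have : Nonempty X := by
    by_contra hX
    rw [not_nonempty_iff] at hX
    exact hne (Measure.eq_zero_of_isEmpty _)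
  obtain ⟨p, hp⟩ := Filter.exists_singleton_mem_of_forall_separating (l := ae (η.restrict C))
    MeasurableSet (fun D hD => by
      rcases hmin D hD with h1 | h1
      · right
        rw [mem_ae_iff, compl_compl, Measure.restrict_apply hD, Set.inter_comm, h1]
      · left
        rw [mem_ae_iff, Measure.restrict_apply hD.compl]
        have h2 := measure_inter_add_sdiff (μ := η) C hD
        rw [hCn] at h2
        have h3 : (n : ℝ≥0∞) + η (C \ D) ≤ n + 0 := by
          rw [add_zero]; exact (add_le_add h1 le_rfl).trans h2.le
        have h4 := (ENNReal.add_le_add_iff_left (ENNReal.natCast_ne_top n)).1 h3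
        rw [Set.inter_comm, ← Set.sdiff_eq]
        simpa using h4)
  rw [mem_ae_iff, Measure.restrict_apply (measurableSet_singleton p).compl] at hp
  have h2 := measure_inter_add_sdiff (μ := η) C (measurableSet_singleton p)
  have h3 : η (C \ {p}) = 0 := by rw [Set.sdiff_eq, Set.inter_comm]; exact hp
  rw [h3, add_zero, hCn] at h2
  have hpC : p ∈ C := by
    by_contra hpC
    rw [Set.inter_singleton_eq_empty.2 hpC, measure_empty] at h2
    exact hCpos h2.symm
  refine ⟨p, hCB hpC, fun h5 => hCpos ?_⟩
  rw [← h2]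
  exact measure_mono_null Set.inter_subset_right h5

/-! ### Locally finite counting measures and their points -/

section Points

variable {d : ℕ} {A : Type*} {α : ℕ} [MeasurableSpace A] [StandardBorelSpace A]

theorem measurableSet_fst_preimage {W : Set (Space d)} (hW : MeasurableSet W) :
    MeasurableSet {p : MarkedPoint d A α | p.1 ∈ W} := measurable_fst hW

theorem IsLocallyFiniteCounting.lt_top {ψ : Measure (MarkedPoint d A α)}
    (h : IsLocallyFiniteCounting ψ) {W : Set (Space d)} (hWb : Bornology.IsBounded W) :
    ψ {p | p.1 ∈ W} < ∞ := by
  obtain ⟨r, hr⟩ := hWb.subset_closedBall 0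
  refine lt_of_le_of_lt (measure_mono ?_) (h.locallyFinite _
    (Metric.isClosed_closedBall (x := (0 : Space d)) (ε := r)).measurableSet Metric.isBounded_closedBall)
  intro p hp
  exact ⟨hr hp, trivial⟩

theorem IsLocallyFiniteCounting.one_le {ψ : Measure (MarkedPoint d A α)}
    (h : IsLocallyFiniteCounting ψ) {p : MarkedPoint d A α} (hp : p ∈ points ψ) : 1 ≤ ψ {p} := by
  rcases h.counting {p} (measurableSet_singleton p) with h' | ⟨n, hn⟩
  · simp [h']
  · rw [hn]
    have : n ≠ 0 := fun h0 => hp (by simp [hn, h0])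
    exact_mod_cast Nat.one_le_iff_ne_zero.2 this

theorem IsLocallyFiniteCounting.card_le {ψ : Measure (MarkedPoint d A α)}
    (h : IsLocallyFiniteCounting ψ) {s : Finset (MarkedPoint d A α)} (hs : ↑s ⊆ points ψ) :
    (s.card : ℝ≥0∞) ≤ ψ s := by
  rw [← sum_measure_singleton, Finset.card_eq_sum_ones, Nat.cast_sum]
  exact Finset.sum_le_sum fun p hp => by simpa using h.one_le (hs hp)

theorem IsLocallyFiniteCounting.finite_of_lt_top {ψ : Measure (MarkedPoint d A α)}
    (h : IsLocallyFiniteCounting ψ) {B : Set (MarkedPoint d A α)} (hB : ψ B < ∞) :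
    {p | p ∈ points ψ ∧ p ∈ B}.Finite := by
  by_contra hinf
  obtain ⟨n, hn⟩ := ENNReal.exists_nat_gt hB.ne
  obtain ⟨s, hs, hsn⟩ := Set.Infinite.exists_subset_card_eq hinf n
  have h1 := h.card_le (s := s) (fun p hp => (hs hp).1)
  have h2 : ψ s ≤ ψ B := measure_mono fun p hp => (hs hp).2
  rw [hsn] at h1
  exact absurd (h1.trans h2) (not_le.2 hn)

theorem IsLocallyFiniteCounting.finite_points {ψ : Measure (MarkedPoint d A α)}
    (h : IsLocallyFiniteCounting ψ) {W : Set (Space d)} (hWb : Bornology.IsBounded W) :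
    {p | p ∈ points ψ ∧ p.1 ∈ W}.Finite :=
  h.finite_of_lt_top (h.lt_top hWb)

theorem isBounded_of_forall_abs_le {W : Set (Space d)} (r : Fin d → ℝ)
    (h : ∀ x ∈ W, ∀ i, |x i| ≤ r i) : Bornology.IsBounded W := by
  rw [isBounded_iff_forall_norm_le]
  refine ⟨∑ i, r i, fun x hx => ?_⟩
  calc ‖x‖ = ‖∑ i, EuclideanSpace.single i (x i)‖ := by
        congr 1; ext j; simp [Finset.sum_apply]
    _ ≤ ∑ i, ‖EuclideanSpace.single i (x i)‖ := norm_sum_le _ _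
    _ ≤ _ := Finset.sum_le_sum fun i _ => by simpa using h x hx i

theorem isBounded_cubeIndex (z : ℕ ≃ (Fin d → ℤ)) (k : ℕ) :
    Bornology.IsBounded {x : Space d | cubeIndex z x = k} := by
  refine isBounded_of_forall_abs_le (fun i => |(z k i : ℝ)| + 1) fun x hx i => ?_
  have hx' : (fun i => ⌊x i⌋) = z k := by
    rw [← (show cubeIndex z x = k from hx)]; simp [cubeIndex]
  have h1 := congrFun hx' i
  have h2 := Int.floor_le (x i)
  have h3 := Int.lt_floor_add_one (x i)
  simp only at h1
  rw [h1] at h2 h3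
  have := neg_abs_le (z k i : ℝ)
  have := le_abs_self (z k i : ℝ)
  rw [abs_le]
  constructor <;> linarith

theorem measurable_cubeIndex (z : ℕ ≃ (Fin d → ℤ)) :
    Measurable (cubeIndex z : Space d → ℕ) := by
  have : Measurable (fun x : Space d => fun i => ⌊x i⌋) :=
    measurable_pi_lambda _ fun i => Int.measurable_floor.comp
      ((EuclideanSpace.proj (𝕜 := ℝ) i).continuous.measurable)
  exact (measurable_from_top (f := z.symm)).comp (this.mono le_rfl (by
    intro s _; exact (Set.to_countable s).measurableSet))

theorem IsLocallyFiniteCounting.countable_points {ψ : Measure (MarkedPoint d A α)}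
    (h : IsLocallyFiniteCounting ψ) : (points ψ).Countable := by
  have : points ψ ⊆ ⋃ n : ℕ, {p | p ∈ points ψ ∧ p.1 ∈ Metric.ball 0 n} := by
    intro p hp
    obtain ⟨n, hn⟩ := exists_nat_gt ‖p.1‖
    exact Set.mem_iUnion.2 ⟨n, hp, by simpa using hn⟩
  exact (Set.countable_iUnion fun n => (h.finite_points Metric.isBounded_ball).countable).mono this

/-- If the complement had mass in some ball, that finite mass would produce an atom by
`exists_atom`, which is a point of `ψ`. So `ψ` is purely atomic. -/
theorem IsLocallyFiniteCounting.measure_compl_points {ψ : Measure (MarkedPoint d A α)}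
    (h : IsLocallyFiniteCounting ψ) : ψ (points ψ)ᶜ = 0 := by
  have : (points ψ)ᶜ ⊆ ⋃ n : ℕ, {p | p ∉ points ψ ∧ p.1 ∈ Metric.ball 0 n} := by
    intro p hp
    obtain ⟨n, hn⟩ := exists_nat_gt ‖p.1‖
    exact Set.mem_iUnion.2 ⟨n, hp, by simpa using hn⟩
  refine measure_mono_null this (measure_iUnion_null fun n => ?_)
  by_contra h0
  have hm : MeasurableSet {p | p ∉ points ψ ∧ p.1 ∈ Metric.ball 0 n} :=
    h.countable_points.measurableSet.compl.inter
      (measurableSet_fst_preimage Metric.isOpen_ball.measurableSet)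
  obtain ⟨p, hp, hp'⟩ := exists_atom h.counting hm h0
    (((measure_mono fun p hp => hp.2).trans_lt (h.lt_top Metric.isBounded_ball)).ne)
  exact hp.1 hp'

/-- A simple counting measure is the sum of the unit masses in its points. -/
theorem IsLocallyFiniteCounting.lintegral_eq_tsum {ψ : Measure (MarkedPoint d A α)}
    (h : IsLocallyFiniteCounting ψ) (h1 : ∀ p, ψ {p} ≤ 1) (f : MarkedPoint d A α → ℝ≥0∞) :
    ∫⁻ p, f p ∂ψ = ∑' p : points ψ, f p := by
  have hr : ψ.restrict (points ψ) = ψ := by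
    rw [Measure.restrict_eq_self_of_ae_mem]
    exact h.measure_compl_points
  conv_lhs => rw [← hr]
  rw [lintegral_countable f h.countable_points]
  refine tsum_congr fun p => ?_
  rw [le_antisymm (h1 p) (h.one_le p.2), mul_one]

/-- The bridge between the combinatorial side, which counts points, and the measurable side, which
evaluates `ψ` on measurable sets. -/
theorem IsLocallyFiniteCounting.measure_eq_encard {ψ : Measure (MarkedPoint d A α)}
    (h : IsLocallyFiniteCounting ψ) (h1 : ∀ p, ψ {p} ≤ 1) {B : Set (MarkedPoint d A α)}
    (hB : MeasurableSet B) : ψ B = ({p | p ∈ points ψ ∧ p ∈ B}.encard : ℝ≥0∞) := by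
  rw [← lintegral_indicator_one hB, h.lintegral_eq_tsum h1, tsum_subtype (points ψ)]
  have : (points ψ).indicator (B.indicator 1) = ({p | p ∈ points ψ ∧ p ∈ B}.indicator 1 :
      MarkedPoint d A α → ℝ≥0∞) := by
    rw [Set.indicator_indicator]; rfl
  rw [this, ← tsum_subtype]
  simp

end Points


/-! ### Iterated integrals with respect to a kernel -/

section Kernels

variable {T X : Type*} [MeasurableSpace T] [MeasurableSpace X]

/-- A kernel all of whose measures are finite is `s`-finite. -/
theorem isSFiniteKernel_of_finite (κ : Kernel T X) (h : ∀ t, κ t Set.univ < ∞) :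
    IsSFiniteKernel κ := by
  classical
  have hm : Measurable fun t => ⌊(κ t Set.univ).toReal⌋₊ :=
    Nat.measurable_floor.comp (κ.measurable_coe MeasurableSet.univ).ennreal_toReal
  have hs : ∀ n : ℕ, MeasurableSet {t | ⌊(κ t Set.univ).toReal⌋₊ = n} := fun n =>
    hm (measurableSet_singleton n)
  -- No uniform bound on the masses is available, so the parameter space is cut according to the
  -- integer part of the total mass.
  have hsum : κ = Kernel.sum fun n => Kernel.piecewise (hs n) κ 0 := by
    ext t B hB
    rw [Kernel.sum_apply' _ _ hB, tsum_eq_single ⌊(κ t Set.univ).toReal⌋₊]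
    · simp [Kernel.piecewise_apply]
    · intro n hn
      rw [Kernel.piecewise_apply, if_neg (fun h' => hn h'.symm)]
      simp
  rw [hsum]
  have : ∀ n : ℕ, IsFiniteKernel (Kernel.piecewise (hs n) κ 0) := fun n => by
    refine ⟨⟨(n : ℝ≥0∞) + 1, by simp, fun t => ?_⟩⟩
    rw [Kernel.piecewise_apply]
    split_ifs with ht
    · have h1 := Nat.lt_floor_add_one (κ t Set.univ).toReal
      rw [show ⌊(κ t Set.univ).toReal⌋₊ = n from ht] at h1
      rw [← ENNReal.ofReal_toReal (h t).ne]
      refine (ENNReal.ofReal_le_ofReal h1.le).trans ?_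
      rw [ENNReal.ofReal_add (by positivity) zero_le_one]
      simp
    · simp
  infer_instance

/-- The iterated integral of a function of `n` variables. -/
def tupleIntegral (μ : Measure X) : (n : ℕ) → ((Fin n → X) → ℝ≥0∞) → ℝ≥0∞
  | 0, f => f Fin.elim0
  | n + 1, f => ∫⁻ x, tupleIntegral μ n (fun q => f (Fin.cons x q)) ∂μ

theorem measurable_finCons {n : ℕ} :
    Measurable fun x : X × (Fin n → X) => (Fin.cons x.1 x.2 : Fin (n + 1) → X) := by
  refine measurable_pi_lambda _ fun i => ?_
  refine Fin.cases ?_ (fun i => ?_) i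
  · simpa using measurable_fst
  · simpa using (by fun_prop : Measurable fun x : X × (Fin n → X) => x.2 i)

/-- The tuple of length `k` stores the variables that are not yet integrated. It makes the induction
on `n` close: the outermost integration variable is moved to the front of this tuple. -/
theorem measurable_tupleIntegral_aux (κ : Kernel T X) [IsSFiniteKernel κ] : ∀ (n k : ℕ)
    (f : T × (Fin k → X) × (Fin n → X) → ℝ≥0∞), Measurable f →
    Measurable fun s : T × (Fin k → X) => tupleIntegral (κ s.1) n (fun q => f (s.1, s.2, q))
  | 0, k, f, hf => by
    simp only [tupleIntegral]
    exact hf.comp (by fun_prop)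
  | n + 1, k, f, hf => by
    have ih := measurable_tupleIntegral_aux κ n (k + 1)
      (fun x => f (x.1, Fin.tail x.2.1, Fin.cons (x.2.1 0) x.2.2)) (hf.comp (by
        refine measurable_fst.prodMk (Measurable.prodMk ?_ ?_)
        · exact measurable_pi_lambda _ fun i => by unfold Fin.tail; fun_prop
        · exact measurable_finCons.comp (by fun_prop :
            Measurable fun x : T × (Fin (k + 1) → X) × (Fin n → X) => (x.2.1 0, x.2.2))))
    have h2 : Measurable fun s : (T × (Fin k → X)) × X => tupleIntegral (κ s.1.1) n
        (fun q => f (s.1.1, s.1.2, Fin.cons s.2 q)) := by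
      have hg : Measurable fun s : (T × (Fin k → X)) × X =>
          (s.1.1, (Fin.cons s.2 s.1.2 : Fin (k + 1) → X)) :=
        Measurable.prodMk (by fun_prop) (measurable_finCons.comp (by fun_prop :
            Measurable fun s : (T × (Fin k → X)) × X => (s.2, s.1.2)))
      simpa [Function.comp_def] using ih.comp hg
    exact Measurable.lintegral_kernel_prod_right'
      (κ := κ.comap (Prod.fst : T × (Fin k → X) → T) measurable_fst) h2

theorem measurable_tupleIntegral (κ : Kernel T X) [IsSFiniteKernel κ] (n : ℕ)
    {f : T × (Fin n → X) → ℝ≥0∞} (hf : Measurable f) :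
    Measurable fun t : T => tupleIntegral (κ t) n (fun q => f (t, q)) :=
  (measurable_tupleIntegral_aux κ n 0 (fun x => f (x.1, x.2.2)) (hf.comp (by fun_prop))).comp
    (by fun_prop : Measurable fun t : T => (t, (Fin.elim0 : Fin 0 → X)))

end Kernels

/-! ### Simple configurations and the measurable space of configurations -/

section Points

variable {d : ℕ} {A : Type*} {α : ℕ} [MeasurableSpace A] [StandardBorelSpace A]

/-- A locally finite simple counting measure whose points have different locations and
different ordering components. -/
structure IsSimple (ψ : Measure (MarkedPoint d A α)) : Prop where
  counting : IsLocallyFiniteCounting ψ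
  le_one : ∀ p, ψ {p} ≤ 1
  time_inj : Set.InjOn MarkedPoint.time (points ψ)
  fst_inj : Set.InjOn (fun p => p.1) (points ψ)

theorem IsSimple.vertex_inj {ψ : Measure (MarkedPoint d A α)} (h : IsSimple ψ) :
    Set.InjOn MarkedPoint.vertex (points ψ) := fun _ hp _ hq hpq =>
  h.fst_inj hp hq (congrArg (Prod.fst : Space d × A → Space d) hpq)

/-- The sum includes tuples with repetitions. Integrands supported on tuples with strictly
increasing times remove them and make each finite set of points count once. -/
theorem IsSimple.tupleIntegral_eq {ψ : Measure (MarkedPoint d A α)} (h : IsSimple ψ) :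
    ∀ (n : ℕ) (f : (Fin n → MarkedPoint d A α) → ℝ≥0∞),
    tupleIntegral ψ n f = ∑' q : Fin n → points ψ, f (fun i => q i)
  | 0, f => by
    rw [tupleIntegral, tsum_eq_single default (fun q hq => absurd (Subsingleton.elim q _) hq)]
    congr 1
    exact Subsingleton.elim _ _
  | n + 1, f => by
    rw [tupleIntegral, h.counting.lintegral_eq_tsum h.le_one,
      ← (Fin.consEquiv fun _ : Fin (n + 1) => points ψ).tsum_eq, ENNReal.tsum_prod']
    refine tsum_congr fun p => ?_
    rw [h.tupleIntegral_eq n]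
    refine tsum_congr fun q => ?_
    congr 1
    ext i : 1
    refine Fin.cases ?_ (fun i => ?_) i <;> simp [Fin.consEquiv]

variable (d A α) in
/-- The space of locally finite counting measures. -/
abbrev Config : Type _ :=
  {ψ : Measure (MarkedPoint d A α) // IsLocallyFiniteCounting ψ}

variable (d A α) in
/-- The identity, as a kernel from counting measures to points. -/
def configKernel : Kernel (Config d A α) (MarkedPoint d A α) :=
  ⟨Subtype.val, measurable_subtype_coe⟩

theorem configKernel_apply (ψ : Config d A α) : configKernel d A α ψ = ψ.1 := rfl

/-- Local finiteness is used on the shells where `‖x‖` has a given integer part. Each shell is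
bounded, so each restricted kernel consists of finite measures. -/
instance isSFiniteKernel_configKernel : IsSFiniteKernel (configKernel d A α) := by
  have hm : ∀ n : ℕ, MeasurableSet {p : MarkedPoint d A α | ⌊‖p.1‖⌋₊ = n} := fun n =>
    (Nat.measurable_floor.comp measurable_fst.norm) (measurableSet_singleton n)
  have hsum : configKernel d A α = Kernel.sum fun n => (configKernel d A α).restrict (hm n) := by
    ext ψ : 1
    rw [Kernel.sum_apply]
    simp_rw [Kernel.restrict_apply]
    rw [← Measure.restrict_iUnion (fun i j hij => Set.disjoint_left.2 fun p hp hq =>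
      hij (hp.symm.trans hq)) hm]
    have hu : ⋃ n : ℕ, {p : MarkedPoint d A α | ⌊‖p.1‖⌋₊ = n} = Set.univ :=
      Set.iUnion_eq_univ_iff.2 fun p => ⟨_, rfl⟩
    rw [hu, Measure.restrict_univ]
  rw [hsum]
  have : ∀ n, IsSFiniteKernel ((configKernel d A α).restrict (hm n)) := fun n => by
    refine isSFiniteKernel_of_finite _ fun ψ => ?_
    rw [Kernel.restrict_apply, Measure.restrict_apply_univ, configKernel_apply]
    refine (measure_mono ?_).trans_lt (ψ.2.lt_top (Metric.isBounded_ball (x := 0) (r := n + 1)))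
    intro p hp
    have := Nat.lt_floor_add_one ‖p.1‖
    rw [show ⌊‖p.1‖⌋₊ = n from hp] at this
    simpa using this
  infer_instance

/-- The set whose mass is taken may itself depend on the configuration, as it does for ranks,
degrees and connected points. -/
theorem measurable_config_measure {T : Type*} [MeasurableSpace T] {g : T → Config d A α}
    (hg : Measurable g) {s : Set (T × MarkedPoint d A α)} (hs : MeasurableSet s) :
    Measurable fun t => (g t).1 {p | (t, p) ∈ s} :=
  Kernel.measurable_kernel_prodMk_left (κ := (configKernel d A α).comap g hg) hs

/-! ### Measurability of the coordinates -/

theorem measurable_time : Measurable (MarkedPoint.time : MarkedPoint d A α → unitInterval) :=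
  measurable_snd.snd.fst

theorem measurable_vertex : Measurable (MarkedPoint.vertex : MarkedPoint d A α → Space d × A) :=
  measurable_fst.prodMk measurable_snd.fst

theorem measurable_decision :
    Measurable (MarkedPoint.decision : MarkedPoint d A α → Decision α) :=
  measurable_snd.snd.snd

/-- The coordinates of a point, expressed through the measure of a set. -/
def coordinatesAux (z : ℕ ≃ (Fin d → ℤ)) (ψ : Measure (MarkedPoint d A α))
    (p : MarkedPoint d A α) : ℕ × ℕ :=
  (cubeIndex z p.1,
    ⌊(ψ {q | cubeIndex z q.1 = cubeIndex z p.1 ∧ q.time ≤ p.time}).toReal⌋₊)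

theorem measurableSet_rank (z : ℕ ≃ (Fin d → ℤ)) :
    MeasurableSet {x : MarkedPoint d A α × MarkedPoint d A α |
      cubeIndex z x.2.1 = cubeIndex z x.1.1 ∧ x.2.time ≤ x.1.time} := by
  have h1 : MeasurableSet {x : MarkedPoint d A α × MarkedPoint d A α |
      cubeIndex z x.2.1 = cubeIndex z x.1.1} :=
    measurableSet_eq_fun ((measurable_cubeIndex z).comp measurable_snd.fst)
      ((measurable_cubeIndex z).comp measurable_fst.fst)
  have h2 : Measurable fun x : MarkedPoint d A α × MarkedPoint d A α => x.1.time :=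
    measurable_time.comp measurable_fst
  have h3 : Measurable fun x : MarkedPoint d A α × MarkedPoint d A α => x.2.time :=
    measurable_time.comp measurable_snd
  have h4 : MeasurableSet {x : MarkedPoint d A α × MarkedPoint d A α |
      x.2.time ≤ x.1.time} := measurableSet_le h3 h2
  exact h1.inter h4

theorem measurable_coordinatesAux (z : ℕ ≃ (Fin d → ℤ)) :
    Measurable fun x : Config d A α × MarkedPoint d A α => coordinatesAux z x.1.1 x.2 := by
  refine Measurable.prodMk ((measurable_cubeIndex z).comp measurable_snd.fst) ?_
  refine Nat.measurable_floor.comp (Measurable.ennreal_toReal ?_)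
  exact measurable_config_measure (g := fun x : Config d A α × MarkedPoint d A α => x.1)
    measurable_fst ((by fun_prop : Measurable
      fun x : (Config d A α × MarkedPoint d A α) × MarkedPoint d A α => (x.1.2, x.2))
      (measurableSet_rank z))

theorem finite_rank {ψ : Measure (MarkedPoint d A α)} (h : IsLocallyFiniteCounting ψ)
    (z : ℕ ≃ (Fin d → ℤ)) (p : MarkedPoint d A α) :
    {q | q ∈ points ψ ∧ cubeIndex z q.1 = cubeIndex z p.1 ∧ q.time ≤ p.time}.Finite :=
  (h.finite_points (isBounded_cubeIndex z (cubeIndex z p.1))).subset fun _ hq => ⟨hq.1, hq.2.1⟩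

theorem IsSimple.coordinatesAux_eq {ψ : Measure (MarkedPoint d A α)} (h : IsSimple ψ)
    (z : ℕ ≃ (Fin d → ℤ)) (p : MarkedPoint d A α) :
    coordinatesAux z ψ p = coordinates z ψ p := by
  have hm : MeasurableSet {q : MarkedPoint d A α |
      cubeIndex z q.1 = cubeIndex z p.1 ∧ q.time ≤ p.time} :=
    (by fun_prop : Measurable fun q : MarkedPoint d A α => (p, q)) (measurableSet_rank z)
  rw [coordinatesAux, coordinates, h.counting.measure_eq_encard h.le_one hm]
  congr 1
  have hfin := finite_rank h.counting z p
  simp only [Set.mem_ofPred_eq]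
  rw [← hfin.cast_ncard_eq]
  simp

/-- Different points have different coordinates. -/
theorem IsSimple.coordinates_injOn {ψ : Measure (MarkedPoint d A α)} (h : IsSimple ψ)
    (z : ℕ ≃ (Fin d → ℤ)) : Set.InjOn (coordinates z ψ) (points ψ) := by
  have key : ∀ p ∈ points ψ, ∀ q ∈ points ψ, coordinates z ψ p = coordinates z ψ q →
      p.time ≤ q.time → q.time ≤ p.time := by
    intro p hp q hq hpq hle
    have h1 : cubeIndex z p.1 = cubeIndex z q.1 := congrArg Prod.fst hpq
    have h2 := congrArg Prod.snd hpq
    simp only [coordinates] at h2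
    have hsub : {r | r ∈ points ψ ∧ cubeIndex z r.1 = cubeIndex z p.1 ∧ r.time ≤ p.time} ⊆
        {r | r ∈ points ψ ∧ cubeIndex z r.1 = cubeIndex z q.1 ∧ r.time ≤ q.time} :=
      fun r hr => ⟨hr.1, hr.2.1.trans h1, hr.2.2.trans hle⟩
    -- Within one cube the sets of earlier points are nested, so equal ranks force equal sets.
    have heq := Set.eq_of_subset_of_ncard_le hsub h2.ge (finite_rank h.counting z q)
    have hq' : q ∈ {r | r ∈ points ψ ∧ cubeIndex z r.1 = cubeIndex z q.1 ∧ r.time ≤ q.time} :=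
      ⟨hq, rfl, le_rfl⟩
    rw [← heq] at hq'
    exact hq'.2.2
  intro p hp q hq hpq
  apply h.time_inj hp hq
  rcases le_total p.time q.time with h1 | h1
  · exact le_antisymm h1 (key p hp q hq hpq h1)
  · exact le_antisymm (key q hq p hp hpq.symm h1) h1

end Points


/-! ### Measurability of the number of vertices of a given degree -/

section Degrees

variable {d : ℕ} {A : Type*} {α : ℕ} [MeasurableSpace A] [StandardBorelSpace A]

/-- The points `q 0, …, q m`, in increasing order, satisfy the condition for spanning a simplex. -/
def IsSimplexTuple (z : ℕ ≃ (Fin d → ℤ)) (φ : (j : ℕ) → (Fin (j + 1) → Space d × A) → ℝ)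
    (ψ : Measure (MarkedPoint d A α)) (m : ℕ) (q : Fin (m + 1) → MarkedPoint d A α) : Prop :=
  ∀ (j : Set.Icc 1 α) (s : Fin ((j : ℕ) + 1) ↪o Fin (m + 1)),
    (((q (s (Fin.last j))).decision ⟨j, fun i => coordinatesAux z ψ (q (s i.castSucc))⟩ :
      unitInterval) : ℝ) ≤ φ j (fun i => (q (s i)).vertex)

/-- The increasing `(m + 1)`-tuples that contain `p` and span a simplex in `W`. -/
def tupleSet (z : ℕ ≃ (Fin d → ℤ)) (φ : (j : ℕ) → (Fin (j + 1) → Space d × A) → ℝ)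
    (W : Set (Space d)) (m : ℕ) (ψ : Measure (MarkedPoint d A α)) (p : MarkedPoint d A α) :
    Set (Fin (m + 1) → MarkedPoint d A α) :=
  {q | StrictMono (fun i => (q i).time) ∧ (∀ i, (q i).1 ∈ W) ∧ m ≤ α ∧
    IsSimplexTuple z φ ψ m q ∧ ∃ i, q i = p}

/-- The `m`-simplex degree, as an iterated integral. -/
def degreeAux (z : ℕ ≃ (Fin d → ℤ)) (φ : (j : ℕ) → (Fin (j + 1) → Space d × A) → ℝ)
    (W : Set (Space d)) (m : ℕ) (ψ : Measure (MarkedPoint d A α)) (p : MarkedPoint d A α) :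
    ℝ≥0∞ :=
  tupleIntegral ψ (m + 1) ((tupleSet z φ W m ψ p).indicator 1)

/-- The evaluated component is random, but its index ranges over a countable set, so joint
measurability follows from that of each projection. -/
theorem measurable_decision_apply (j : Set.Icc 1 α) :
    Measurable fun x : Decision α × (Fin (j : ℕ) → ℕ × ℕ) => x.1 ⟨j, x.2⟩ :=
  measurable_from_prod_countable_left fun y => measurable_pi_apply (⟨j, y⟩ : DecisionIndex α)

theorem measurableSet_isSimplexTuple (z : ℕ ≃ (Fin d → ℤ))
    {φ : (j : ℕ) → (Fin (j + 1) → Space d × A) → ℝ}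
    (hφ : ∀ j, 1 ≤ j → j ≤ α → Measurable (φ j)) (m : ℕ) :
    MeasurableSet {x : Config d A α × (Fin (m + 1) → MarkedPoint d A α) |
      IsSimplexTuple z φ x.1.1 m x.2} := by
  simp only [IsSimplexTuple, Set.ofPred_forall]
  refine MeasurableSet.iInter fun j => MeasurableSet.iInter fun s => ?_
  have h0 : ∀ i, Measurable fun x : Config d A α × (Fin (m + 1) → MarkedPoint d A α) => x.2 i :=
    fun i => by fun_prop
  refine measurableSet_le ?_ ?_
  · refine measurable_subtype_coe.comp ((measurable_decision_apply j).comp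
      (Measurable.prodMk (measurable_decision.comp (h0 _)) (measurable_pi_lambda _ fun i => ?_)))
    exact (measurable_coordinatesAux z).comp (measurable_fst.prodMk (h0 _))
  · exact (hφ j j.2.1 j.2.2).comp (measurable_pi_lambda _ fun i => measurable_vertex.comp (h0 _))

theorem measurableSet_tupleSet (z : ℕ ≃ (Fin d → ℤ))
    {φ : (j : ℕ) → (Fin (j + 1) → Space d × A) → ℝ}
    (hφ : ∀ j, 1 ≤ j → j ≤ α → Measurable (φ j)) {W : Set (Space d)} (hW : MeasurableSet W)
    (m : ℕ) :
    MeasurableSet {x : (Config d A α × MarkedPoint d A α) × (Fin (m + 1) → MarkedPoint d A α) |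
      x.2 ∈ tupleSet z φ W m x.1.1.1 x.1.2} := by
  have h0 : ∀ i, Measurable fun x : (Config d A α × MarkedPoint d A α) ×
      (Fin (m + 1) → MarkedPoint d A α) => x.2 i := fun i => by fun_prop
  have ht : ∀ i, Measurable fun x : (Config d A α × MarkedPoint d A α) ×
      (Fin (m + 1) → MarkedPoint d A α) => (x.2 i).time := fun i => measurable_time.comp (h0 i)
  have h1 : MeasurableSet {x : (Config d A α × MarkedPoint d A α) ×
      (Fin (m + 1) → MarkedPoint d A α) | StrictMono fun i => (x.2 i).time} := by
    simp only [StrictMono, Set.ofPred_forall]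
    exact MeasurableSet.iInter fun i => MeasurableSet.iInter fun j => MeasurableSet.iInter fun _ =>
      measurableSet_lt (ht i) (ht j)
  have h2 : MeasurableSet {x : (Config d A α × MarkedPoint d A α) ×
      (Fin (m + 1) → MarkedPoint d A α) | ∀ i, (x.2 i).1 ∈ W} := by
    simp only [Set.ofPred_forall]
    exact MeasurableSet.iInter fun i => (measurable_fst.comp (h0 i)) hW
  have h3 : MeasurableSet {x : (Config d A α × MarkedPoint d A α) ×
      (Fin (m + 1) → MarkedPoint d A α) | IsSimplexTuple z φ x.1.1.1 m x.2} :=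
    (by fun_prop : Measurable fun x : (Config d A α × MarkedPoint d A α) ×
      (Fin (m + 1) → MarkedPoint d A α) => (x.1.1, x.2)) (measurableSet_isSimplexTuple z hφ m)
  have h4 : MeasurableSet {x : (Config d A α × MarkedPoint d A α) ×
      (Fin (m + 1) → MarkedPoint d A α) | ∃ i, x.2 i = x.1.2} := by
    simp only [Set.ofPred_exists]
    exact MeasurableSet.iUnion fun i => measurableSet_eq_fun (h0 i) (by fun_prop)
  exact h1.inter (h2.inter ((MeasurableSet.const _).inter (h3.inter h4)))

theorem measurable_degreeAux (z : ℕ ≃ (Fin d → ℤ))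
    {φ : (j : ℕ) → (Fin (j + 1) → Space d × A) → ℝ}
    (hφ : ∀ j, 1 ≤ j → j ≤ α → Measurable (φ j)) {W : Set (Space d)} (hW : MeasurableSet W)
    (m : ℕ) :
    Measurable fun x : Config d A α × MarkedPoint d A α => degreeAux z φ W m x.1.1 x.2 :=
  measurable_tupleIntegral ((configKernel d A α).comap Prod.fst measurable_fst) (m + 1)
    (f := {x : (Config d A α × MarkedPoint d A α) × (Fin (m + 1) → MarkedPoint d A α) |
      x.2 ∈ tupleSet z φ W m x.1.1.1 x.1.2}.indicator 1)
    (measurable_one.indicator (measurableSet_tupleSet z hφ hW m))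

/-- The number of vertices of given degree, expressed through integrals. -/
def numVerticesAux (z : ℕ ≃ (Fin d → ℤ)) (φ : (j : ℕ) → (Fin (j + 1) → Space d × A) → ℝ)
    (W : Set (Space d)) (m l : ℕ) (ψ : Measure (MarkedPoint d A α)) : ℝ :=
  (ψ {p | p.1 ∈ W ∧ degreeAux z φ W m ψ p = l}).toReal

theorem measurableSet_degreeAux (z : ℕ ≃ (Fin d → ℤ))
    {φ : (j : ℕ) → (Fin (j + 1) → Space d × A) → ℝ}
    (hφ : ∀ j, 1 ≤ j → j ≤ α → Measurable (φ j)) {W : Set (Space d)} (hW : MeasurableSet W)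
    (m l : ℕ) : MeasurableSet {x : Config d A α × MarkedPoint d A α |
      x.2.1 ∈ W ∧ degreeAux z φ W m x.1.1 x.2 = l} :=
  MeasurableSet.inter (measurable_snd.fst hW)
    (measurableSet_eq_fun (measurable_degreeAux z hφ hW m) measurable_const)

theorem measurable_numVerticesAux (z : ℕ ≃ (Fin d → ℤ))
    {φ : (j : ℕ) → (Fin (j + 1) → Space d × A) → ℝ}
    (hφ : ∀ j, 1 ≤ j → j ≤ α → Measurable (φ j)) {W : Set (Space d)} (hW : MeasurableSet W)
    (m l : ℕ) : Measurable fun ψ : Config d A α => numVerticesAux z φ W m l ψ.1 :=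
  (measurable_config_measure measurable_id (measurableSet_degreeAux z hφ hW m l)).ennreal_toReal

/-! ### Simplices and increasing tuples of points -/

theorem mem_faces_restrictTo {K : PreAbstractSimplicialComplex (Space d × A)} {W : Set (Space d)}
    {σ : Finset (Space d × A)} :
    σ ∈ (restrictTo K W).faces ↔ σ ∈ K.faces ∧ ∀ v ∈ σ, v.1 ∈ W := Iff.rfl

theorem mem_faces_complex {z : ℕ ≃ (Fin d → ℤ)} {φ : (j : ℕ) → (Fin (j + 1) → Space d × A) → ℝ}
    {ψ : Measure (MarkedPoint d A α)} {σ : Finset (Space d × A)} :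
    σ ∈ (complex z φ ψ).faces ↔ σ.Nonempty ∧ σ.card ≤ α + 1 ∧
    (∀ v ∈ σ, ∃ p ∈ points ψ, p.vertex = v) ∧
    ∀ (j : Set.Icc 1 α) (p : Fin ((j : ℕ) + 1) → MarkedPoint d A α),
      (∀ i, p i ∈ points ψ) → (∀ i, (p i).vertex ∈ σ) → StrictMono (fun i => (p i).time) →
      (decisionValue z ψ j p : ℝ) ≤ φ j (fun i => (p i).vertex) := Iff.rfl

open Classical in
/-- The set of vertices of the points of a tuple. -/
def tupleVertices {n : ℕ} (q : Fin n → MarkedPoint d A α) : Finset (Space d × A) :=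
  Finset.univ.image fun i => (q i).vertex

theorem mem_tupleVertices {n : ℕ} {q : Fin n → MarkedPoint d A α} {v : Space d × A} :
    v ∈ tupleVertices q ↔ ∃ i, (q i).vertex = v := by
  simp [tupleVertices]

theorem IsSimple.card_tupleVertices {ψ : Measure (MarkedPoint d A α)} (h : IsSimple ψ) {n : ℕ}
    {q : Fin n → MarkedPoint d A α} (hq : ∀ i, q i ∈ points ψ)
    (ht : StrictMono fun i => (q i).time) : (tupleVertices q).card = n := by
  classical
  rw [tupleVertices, Finset.card_image_of_injective, Finset.card_fin]
  intro i j hij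
  exact ht.injective (congrArg MarkedPoint.time (h.vertex_inj (hq i) (hq j) hij))

/-- Every increasing list of points with vertices in the set is a subtuple of `q` along an order
embedding. This turns a condition quantified over arbitrary points of `ψ` into finitely many
measurable inequalities. -/
theorem IsSimple.tupleVertices_mem_faces {ψ : Measure (MarkedPoint d A α)} (h : IsSimple ψ)
    (z : ℕ ≃ (Fin d → ℤ)) (φ : (j : ℕ) → (Fin (j + 1) → Space d × A) → ℝ) {m : ℕ}
    {q : Fin (m + 1) → MarkedPoint d A α} (hq : ∀ i, q i ∈ points ψ)
    (ht : StrictMono fun i => (q i).time) :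
    tupleVertices q ∈ (complex z φ ψ).faces ↔ m ≤ α ∧ IsSimplexTuple z φ ψ m q := by
  rw [mem_faces_complex, h.card_tupleVertices hq ht, Nat.add_le_add_iff_right]
  have hval : ∀ (j : Set.Icc 1 α) (s : Fin ((j : ℕ) + 1) ↪o Fin (m + 1)),
      decisionValue z ψ j (fun i => q (s i)) = (q (s (Fin.last j))).decision
        ⟨j, fun i => coordinatesAux z ψ (q (s i.castSucc))⟩ := by
    intro j s
    simp only [decisionValue, h.coordinatesAux_eq z]
  constructor
  · rintro ⟨-, h1, -, h3⟩
    refine ⟨h1, fun j s => ?_⟩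
    rw [← hval]
    exact h3 j (fun i => q (s i)) (fun i => hq _) (fun i => mem_tupleVertices.2 ⟨_, rfl⟩)
      (ht.comp s.strictMono)
  · rintro ⟨h1, h2⟩
    refine ⟨⟨_, mem_tupleVertices.2 ⟨0, rfl⟩⟩, h1, fun v hv => ?_, fun j p hp hv hpt => ?_⟩
    · obtain ⟨i, rfl⟩ := mem_tupleVertices.1 hv
      exact ⟨_, hq i, rfl⟩
    · have : ∀ i, ∃ k, q k = p i := fun i => by
        obtain ⟨k, hk⟩ := mem_tupleVertices.1 (hv i)
        exact ⟨k, h.vertex_inj (hq k) (hp i) hk⟩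
      choose s hs using this
      have hsm : StrictMono s := fun i k hik => by
        have := hpt hik
        simp only [← hs] at this
        exact ht.lt_iff_lt.1 this
      have := h2 j (OrderEmbedding.ofStrictMono s hsm)
      rw [← hval] at this
      simpa only [OrderEmbedding.coe_ofStrictMono, hs] using this

/-- Every finite set of vertices is listed by an increasing tuple of points. -/
theorem IsSimple.exists_tupleVertices_eq {ψ : Measure (MarkedPoint d A α)} (h : IsSimple ψ)
    {n : ℕ} {σ : Finset (Space d × A)} (hσ : ∀ v ∈ σ, ∃ p ∈ points ψ, p.vertex = v)
    (hn : σ.card = n) : ∃ q : Fin n → MarkedPoint d A α, (∀ i, q i ∈ points ψ) ∧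
      StrictMono (fun i => (q i).time) ∧ tupleVertices q = σ := by
  classical
  have hσ' : ∀ v, ∃ p : MarkedPoint d A α, v ∈ σ → p ∈ points ψ ∧ p.vertex = v := fun v => by
    by_cases hv : v ∈ σ
    · obtain ⟨p, hp⟩ := hσ v hv
      exact ⟨p, fun _ => hp⟩
    -- Outside `σ` the value is irrelevant; it only makes the choice function total.
    · exact ⟨(v.1, v.2, 0, fun _ => 0), fun h => absurd h hv⟩
  choose g hg' using hσ'
  have hg : ∀ v ∈ σ, g v ∈ points ψ := fun v hv => (hg' v hv).1
  have hgv : ∀ v ∈ σ, (g v).vertex = v := fun v hv => (hg' v hv).2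
  have hinj : Set.InjOn (fun v => (g v).time) σ := fun v hv w hw hvw => by
    rw [← hgv v hv, ← hgv w hw, h.time_inj (hg v hv) (hg w hw) hvw]
  have hT : (σ.image fun v => (g v).time).card = n := by
    rw [Finset.card_image_of_injOn hinj, hn]
  have hmem : ∀ i : Fin n, ∃ v ∈ σ, (g v).time =
      (σ.image fun v => (g v).time).orderEmbOfFin hT i := fun i =>
    Finset.mem_image.1 (Finset.orderEmbOfFin_mem _ hT i)
  choose w hw hwt using hmem
  have hmono : StrictMono fun i => (g (w i)).time := fun i j hij => by
    simp only [hwt]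
    exact (OrderEmbedding.strictMono _) hij
  refine ⟨fun i => g (w i), fun i => hg _ (hw i), hmono, ?_⟩
  refine Finset.eq_of_subset_of_card_le (fun v hv => ?_) ?_
  · obtain ⟨i, rfl⟩ := mem_tupleVertices.1 hv
    rw [hgv _ (hw i)]
    exact hw i
  · rw [h.card_tupleVertices (fun i => hg _ (hw i)) hmono, hn]

/-- Equal vertex sets give equal sets of times, and a strictly increasing finite sequence is
determined by its range. -/
theorem IsSimple.tupleVertices_injOn {ψ : Measure (MarkedPoint d A α)} (h : IsSimple ψ) (n : ℕ) :
    Set.InjOn tupleVertices {q : Fin n → MarkedPoint d A α | (∀ i, q i ∈ points ψ) ∧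
      StrictMono fun i => (q i).time} := by
  rintro q ⟨hq, hqt⟩ r ⟨hr, hrt⟩ hqr
  have hsub : ∀ {q r : Fin n → MarkedPoint d A α}, (∀ i, q i ∈ points ψ) →
      (∀ i, r i ∈ points ψ) → tupleVertices q = tupleVertices r →
      Set.range (fun i => (q i).time) ⊆ Set.range (fun i => (r i).time) := by
    rintro q r hq hr hqr _ ⟨i, rfl⟩
    have : (q i).vertex ∈ tupleVertices q := mem_tupleVertices.2 ⟨i, rfl⟩
    rw [hqr, mem_tupleVertices] at this
    obtain ⟨k, hk⟩ := this
    exact ⟨k, congrArg MarkedPoint.time (h.vertex_inj (hr k) (hq i) hk)⟩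
  have := (hqt.range_inj hrt).1
    ((hsub hq hr hqr).antisymm (hsub hr hq hqr.symm))
  ext i : 1
  exact h.time_inj (hq i) (hr i) (congrFun this i)

/-- Sorting by time is a bijection between the simplices counted on the right and the tuples counted
on the left. With `encard` the identity also covers infinite degrees, so `W` need not be bounded. -/
theorem IsSimple.degreeAux_eq {ψ : Measure (MarkedPoint d A α)} (h : IsSimple ψ)
    (z : ℕ ≃ (Fin d → ℤ)) (φ : (j : ℕ) → (Fin (j + 1) → Space d × A) → ℝ)
    (W : Set (Space d)) (m : ℕ) {p : MarkedPoint d A α} (hp : p ∈ points ψ) :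
    degreeAux z φ W m ψ p = ({σ | σ ∈ (restrictTo (complex z φ ψ) W).faces ∧ p.vertex ∈ σ ∧
      σ.card = m + 1}.encard : ℝ≥0∞) := by
  rw [degreeAux, h.tupleIntegral_eq]
  have himage : tupleVertices '' {q | (∀ i, q i ∈ points ψ) ∧ q ∈ tupleSet z φ W m ψ p} =
      {σ | σ ∈ (restrictTo (complex z φ ψ) W).faces ∧ p.vertex ∈ σ ∧ σ.card = m + 1} := by
    ext σ
    constructor
    · rintro ⟨q, ⟨hq, ht, hW, hm, hs, i, rfl⟩, rfl⟩
      refine ⟨⟨(h.tupleVertices_mem_faces z φ hq ht).2 ⟨hm, hs⟩, fun v hv => ?_⟩,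
        mem_tupleVertices.2 ⟨i, rfl⟩, h.card_tupleVertices hq ht⟩
      obtain ⟨i, rfl⟩ := mem_tupleVertices.1 hv
      exact hW i
    · rintro ⟨⟨hf, hW⟩, hpσ, hc⟩
      obtain ⟨q, hq, ht, rfl⟩ := h.exists_tupleVertices_eq (mem_faces_complex.1 hf).2.2.1 hc
      obtain ⟨hm, hs⟩ := (h.tupleVertices_mem_faces z φ hq ht).1 hf
      obtain ⟨i, hi⟩ := mem_tupleVertices.1 hpσ
      exact ⟨q, ⟨hq, ht, fun i => hW (q i).vertex (mem_tupleVertices.2 ⟨i, rfl⟩), hm, hs, i,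
        h.vertex_inj (hq i) hp hi⟩, rfl⟩
  have hinj : Set.InjOn tupleVertices
      {q | (∀ i, q i ∈ points ψ) ∧ q ∈ tupleSet z φ W m ψ p} :=
    (h.tupleVertices_injOn (m + 1)).mono fun q hq => And.intro hq.1 hq.2.1
  rw [← himage, hinj.encard_image]
  set S := {q | (∀ i, q i ∈ points ψ) ∧ q ∈ tupleSet z φ W m ψ p} with hS
  have hcoe : Function.Injective fun (q : Fin (m + 1) → points ψ) (i : Fin (m + 1)) =>
      (q i : MarkedPoint d A α) := fun q r hqr => by
    ext i : 2
    exact congrFun hqr i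
  have h1 : ∀ q : Fin (m + 1) → points ψ, (tupleSet z φ W m ψ p).indicator
      (1 : (Fin (m + 1) → MarkedPoint d A α) → ℝ≥0∞) (fun i => q i) =
      S.indicator 1 (fun i => (q i : MarkedPoint d A α)) := fun q => by
    by_cases hq : (fun i => (q i : MarkedPoint d A α)) ∈ tupleSet z φ W m ψ p
    · have hqS : (fun i => (q i : MarkedPoint d A α)) ∈ S := ⟨fun i => (q i).2, hq⟩
      rw [Set.indicator_of_mem hq, Set.indicator_of_mem hqS]
    · have hqS : (fun i => (q i : MarkedPoint d A α)) ∉ S := fun h' => hq h'.2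
      rw [Set.indicator_of_notMem hq, Set.indicator_of_notMem hqS]
  rw [tsum_congr h1, hcoe.tsum_eq
      (f := S.indicator (1 : (Fin (m + 1) → MarkedPoint d A α) → ℝ≥0∞)),
    ← tsum_subtype]
  · simp
  · intro q hq
    have hqS : q ∈ S := by
      by_contra hq'
      exact hq (Set.indicator_of_notMem hq' _)
    exact ⟨fun i => ⟨q i, hqS.1 i⟩, rfl⟩

theorem vertex_mem_vertices {ψ : Measure (MarkedPoint d A α)} (z : ℕ ≃ (Fin d → ℤ))
    (φ : (j : ℕ) → (Fin (j + 1) → Space d × A) → ℝ) (h : IsSimple ψ) {W : Set (Space d)}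
    {v : Space d × A} : v ∈ vertices (restrictTo (complex z φ ψ) W) ↔
      ∃ p ∈ points ψ, p.1 ∈ W ∧ p.vertex = v := by
  simp only [vertices, Set.mem_ofPred_eq, mem_faces_restrictTo, mem_faces_complex,
    Finset.mem_singleton, forall_eq]
  constructor
  · rintro ⟨⟨-, -, ⟨p, hp, rfl⟩, -⟩, hW⟩
    exact ⟨p, hp, hW, rfl⟩
  · rintro ⟨p, hp, hW, rfl⟩
    refine ⟨⟨by simp, by simp, ⟨p, hp, rfl⟩, fun j q hq hqp ht => ?_⟩, hW⟩
    exfalso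
    -- A single vertex meets no decision condition: all entries of the tuple would be the same
    -- point, against strictly increasing times.
    have h0 : q 0 = q (Fin.last _) := h.vertex_inj (hq _) (hq _) ((hqp _).trans (hqp _).symm)
    have hlt : (0 : Fin ((j : ℕ) + 1)) < Fin.last _ := by
      rw [Fin.lt_def]; exact j.2.1
    exact absurd (congrArg MarkedPoint.time h0) (ht hlt).ne

theorem IsSimple.finite_vertices {ψ : Measure (MarkedPoint d A α)} (h : IsSimple ψ)
    (z : ℕ ≃ (Fin d → ℤ)) (φ : (j : ℕ) → (Fin (j + 1) → Space d × A) → ℝ)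
    {W : Set (Space d)} (hWb : Bornology.IsBounded W) :
    (vertices (restrictTo (complex z φ ψ) W)).Finite := by
  refine ((h.counting.finite_points hWb).image MarkedPoint.vertex).subset fun v hv => ?_
  obtain ⟨p, hp, hpW, rfl⟩ := (vertex_mem_vertices z φ h).1 hv
  exact ⟨p, ⟨hp, hpW⟩, rfl⟩

theorem finite_faces_of_finite_vertices {ι : Type*} {K : PreAbstractSimplicialComplex ι}
    (h : (vertices K).Finite) : K.faces.Finite := by
  classical
  refine (h.toFinset.powerset.finite_toSet).subset fun σ hσ => ?_
  simp only [Finset.coe_powerset, Set.mem_preimage, Set.mem_powerset_iff, Set.Finite.coe_toFinset]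
  intro v hv
  exact (K.isRelLowerSet_faces hσ).2 (Finset.singleton_subset_iff.2 hv) (by simp)

/-- Boundedness of `W` makes all the sets involved finite, so that `ncard` and its junk value for
infinite sets agree with the integrals. -/
theorem IsSimple.numVertices_eq {ψ : Measure (MarkedPoint d A α)} (h : IsSimple ψ)
    (z : ℕ ≃ (Fin d → ℤ)) {φ : (j : ℕ) → (Fin (j + 1) → Space d × A) → ℝ}
    (hφ : ∀ j, 1 ≤ j → j ≤ α → Measurable (φ j)) {W : Set (Space d)} (hW : MeasurableSet W)
    (hWb : Bornology.IsBounded W) (m l : ℕ) :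
    numVerticesOfDegree m l (restrictTo (complex z φ ψ) W) = numVerticesAux z φ W m l ψ := by
  have hm : MeasurableSet {p | p.1 ∈ W ∧ degreeAux z φ W m ψ p = l} :=
    (measurable_prodMk_left (x := (⟨ψ, h.counting⟩ : Config d A α)))
      (measurableSet_degreeAux z hφ hW m l)
  rw [numVerticesAux, h.counting.measure_eq_encard h.le_one hm, numVerticesOfDegree]
  have hfin := finite_faces_of_finite_vertices (h.finite_vertices z φ hWb)
  have hset : {v | v ∈ vertices (restrictTo (complex z φ ψ) W) ∧
      simplexDegree m v (restrictTo (complex z φ ψ) W) = l} = MarkedPoint.vertex ''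
      {p | p ∈ points ψ ∧ p ∈ {p | p.1 ∈ W ∧ degreeAux z φ W m ψ p = l}} := by
    have hdeg : ∀ p ∈ points ψ, (simplexDegree m p.vertex (restrictTo (complex z φ ψ) W) = l ↔
        degreeAux z φ W m ψ p = l) := fun p hp => by
      rw [h.degreeAux_eq z φ W m hp, simplexDegree, ← (hfin.subset fun σ hσ => hσ.1).cast_ncard_eq]
      simp
    ext v
    constructor
    · rintro ⟨hv, hl⟩
      obtain ⟨p, hp, hpW, rfl⟩ := (vertex_mem_vertices z φ h).1 hv
      exact ⟨p, ⟨hp, hpW, (hdeg p hp).1 hl⟩, rfl⟩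
    · rintro ⟨p, ⟨hp, hpW, hl⟩, rfl⟩
      exact ⟨(vertex_mem_vertices z φ h).2 ⟨p, hp, hpW, rfl⟩, (hdeg p hp).2 hl⟩
  rw [hset, Set.InjOn.ncard_image (h.vertex_inj.mono fun p hp => hp.1),
    ← ((h.counting.finite_points hWb).subset fun p hp => ⟨hp.1, hp.2.1⟩).cast_ncard_eq]
  simp

end Degrees


/-! ### The effect of a vertex on the number of vertices of given degree -/

section Injective

variable {ι κ : Type*}

theorem numVerticesOfDegree_map [DecidableEq κ] {f : ι → κ} (hf : Function.Injective f)
    (m l : ℕ) (K : PreAbstractSimplicialComplex ι) :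
    numVerticesOfDegree m l (K.map f) = numVerticesOfDegree m l K := by
  have hfi : Function.Injective fun σ : Finset ι => σ.image f := Finset.image_injective hf
  have hv : ∀ v, v ∈ vertices (K.map f) ↔ ∃ w ∈ vertices K, f w = v := by
    intro v
    constructor
    · rintro ⟨σ, hσ, hσv⟩
      have hσv' : σ.image f = {v} := hσv
      obtain ⟨w, hw⟩ : ∃ w, σ = {w} := Finset.card_eq_one.1 (by
        rw [← Finset.card_image_of_injective σ hf, hσv', Finset.card_singleton])
      subst hw
      exact ⟨w, hσ, by simpa using hσv'⟩
    · rintro ⟨w, hw, rfl⟩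
      exact ⟨{w}, hw, by simp⟩
  have hdeg : ∀ w, simplexDegree m (f w) (K.map f) = simplexDegree m w K := by
    intro w
    rw [simplexDegree, simplexDegree, ← Set.ncard_image_of_injective _ hfi]
    congr 1
    ext σ
    constructor
    · rintro ⟨⟨τ, hτ, rfl⟩, hw, hc⟩
      refine ⟨τ, ⟨hτ, ?_, ?_⟩, rfl⟩
      · simpa [hf.eq_iff] using hw
      · rwa [Finset.card_image_of_injective τ hf] at hc
    · rintro ⟨τ, ⟨hτ, hw, hc⟩, rfl⟩
      exact ⟨⟨τ, hτ, rfl⟩, Finset.mem_image_of_mem f hw,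
        (Finset.card_image_of_injective τ hf).trans hc⟩
  rw [numVerticesOfDegree, numVerticesOfDegree, ← Set.ncard_image_of_injective _ hf]
  congr 2
  ext v
  constructor
  · rintro ⟨h1, h2⟩
    obtain ⟨w, hw, rfl⟩ := (hv v).1 h1
    exact ⟨w, ⟨hw, (hdeg w).symm.trans h2⟩, rfl⟩
  · rintro ⟨w, ⟨hw, h2⟩, rfl⟩
    exact ⟨(hv _).2 ⟨w, hw, rfl⟩, (hdeg w).trans h2⟩

end Injective

theorem isTranslationInvariant_numVerticesOfDegree (d : ℕ) (A : Type*) (m l : ℕ) :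
    IsTranslationInvariant (d := d) (A := A) (numVerticesOfDegree m l) := by
  classical
  intro K t _
  refine Eq.symm ?_
  convert numVerticesOfDegree_map (f := fun v : Space d × A => (v.1 + t, v.2)) ?_ m l K
  rintro ⟨x, a⟩ ⟨y, b⟩ h
  simpa using h

/-! ### Deleting a vertex: comparison and stabilization -/

section Difference

variable {d : ℕ} {A : Type*}

/-- The vertices of degree `l`. -/
def degreeSet (m l : ℕ) (K : PreAbstractSimplicialComplex (Space d × A)) : Set (Space d × A) :=
  {v | v ∈ vertices K ∧ simplexDegree m v K = l}

/-- The neighbours of the vertex `o`. -/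
def neighbors (K : PreAbstractSimplicialComplex (Space d × A)) (o : Space d × A) :
    Set (Space d × A) :=
  {v | v ≠ o ∧ ∃ σ ∈ K.faces, o ∈ σ ∧ v ∈ σ}

theorem mem_vertices_of_mem {K : PreAbstractSimplicialComplex (Space d × A)}
    {σ : Finset (Space d × A)} (hσ : σ ∈ K.faces) {v : Space d × A} (hv : v ∈ σ) :
    v ∈ vertices K :=
  (K.isRelLowerSet_faces hσ).2 (Finset.singleton_subset_iff.2 hv) (by simp)

theorem mem_vertices_restrictTo {K : PreAbstractSimplicialComplex (Space d × A)}
    {W : Set (Space d)} {v : Space d × A} :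
    v ∈ vertices (restrictTo K W) ↔ v ∈ vertices K ∧ v.1 ∈ W :=
  ⟨fun h => ⟨h.1, h.2 v (Finset.mem_singleton_self v)⟩, fun h => ⟨h.1, fun w hw => by
    rw [Finset.mem_singleton.1 hw]
    exact h.2⟩⟩

theorem restrictTo_restrictTo (K : PreAbstractSimplicialComplex (Space d × A))
    (W W' : Set (Space d)) : restrictTo (restrictTo K W') W = restrictTo K (W ∩ W') := by
  ext σ
  simp only [restrictTo, Set.mem_ofPred_eq, Set.mem_inter_iff]
  grind

/-- A simplex lost by the deletion contains `o`, so all its other vertices are neighbours of `o`.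
The hypothesis `ho` ensures that removing the location of `o` removes no other vertex. -/
theorem degreeSet_diff_neighbors {K : PreAbstractSimplicialComplex (Space d × A)}
    {o : Space d × A} (ho : ∀ v ∈ vertices K, v.1 = o.1 → v = o) (W : Set (Space d)) (m l : ℕ) :
    degreeSet m l (restrictTo K W) \ insert o (neighbors K o) =
      degreeSet m l (restrictTo K (W \ {o.1})) \ insert o (neighbors K o) := by
  ext v
  simp only [Set.mem_sdiff, degreeSet, Set.mem_ofPred_eq, Set.mem_insert_iff, not_or]
  refine and_congr_left fun ⟨hvo, hvn⟩ => ?_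
  have h1 : simplexDegree m v (restrictTo K W) =
      simplexDegree m v (restrictTo K (W \ {o.1})) := by
    simp only [simplexDegree]
    congr 1
    ext σ
    constructor
    · rintro ⟨⟨hσ, hW⟩, hv, hc⟩
      refine ⟨⟨hσ, fun w hw => ⟨hW w hw, fun hwo => ?_⟩⟩, hv, hc⟩
      have := ho w (mem_vertices_of_mem hσ hw) hwo
      subst this
      exact hvn ⟨hvo, σ, hσ, hw, hv⟩
    · rintro ⟨⟨hσ, hW⟩, hv, hc⟩
      exact ⟨⟨hσ, fun w hw => (hW w hw).1⟩, hv, hc⟩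
  rw [h1, mem_vertices_restrictTo, mem_vertices_restrictTo]
  refine and_congr_left fun _ => ⟨fun h => ⟨h.1, h.2, fun h' => hvo (ho v h.1 h')⟩,
    fun h => ⟨h.1, h.2.1⟩⟩

theorem numVertices_sub_eq {K : PreAbstractSimplicialComplex (Space d × A)}
    {o : Space d × A} (ho : ∀ v ∈ vertices K, v.1 = o.1 → v = o) {W : Set (Space d)}
    (hfin : (vertices (restrictTo K W)).Finite) (m l : ℕ) :
    numVerticesOfDegree m l (restrictTo K W) - numVerticesOfDegree m l (restrictTo K (W \ {o.1})) =
      ((degreeSet m l (restrictTo K W) ∩ insert o (neighbors K o)).ncard : ℝ) -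
      (degreeSet m l (restrictTo K (W \ {o.1})) ∩ insert o (neighbors K o)).ncard := by
  have hsub : vertices (restrictTo K (W \ {o.1})) ⊆ vertices (restrictTo K W) := fun v hv => by
    rw [mem_vertices_restrictTo] at hv ⊢
    exact ⟨hv.1, hv.2.1⟩
  have h1 := Set.ncard_inter_add_ncard_sdiff_eq_ncard (degreeSet m l (restrictTo K W))
    (insert o (neighbors K o)) (hfin.subset fun v hv => hv.1)
  have h2 := Set.ncard_inter_add_ncard_sdiff_eq_ncard (degreeSet m l (restrictTo K (W \ {o.1})))
    (insert o (neighbors K o)) (hfin.subset fun v hv => hsub hv.1)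
  have h3 : ∀ K : PreAbstractSimplicialComplex (Space d × A),
      numVerticesOfDegree m l K = (degreeSet m l K).ncard := fun K => rfl
  rw [h3, h3, ← h1, ← h2, degreeSet_diff_neighbors ho]
  push_cast
  ring

/-- Both terms of `numVertices_sub_eq` lie between zero and the right-hand side, so no factor two
appears. -/
theorem abs_numVertices_sub_le {K : PreAbstractSimplicialComplex (Space d × A)}
    {o : Space d × A} (ho : ∀ v ∈ vertices K, v.1 = o.1 → v = o) {W : Set (Space d)}
    (hfin : (vertices (restrictTo K W)).Finite) (m l : ℕ) :
    |numVerticesOfDegree m l (restrictTo K W) -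
      numVerticesOfDegree m l (restrictTo K (W \ {o.1}))| ≤
      1 + ({v | v ∈ neighbors K o ∧ v.1 ∈ W}.ncard : ℝ) := by
  rw [numVertices_sub_eq ho hfin]
  have hN : {v | v ∈ neighbors K o ∧ v.1 ∈ W}.Finite := hfin.subset fun v hv => by
    obtain ⟨⟨-, σ, hσ, -, hv'⟩, hW⟩ := hv
    exact mem_vertices_restrictTo.2 ⟨mem_vertices_of_mem hσ hv', hW⟩
  have key : ∀ s : Set (Space d × A), (∀ v ∈ s, v.1 ∈ W) →
      ((s ∩ insert o (neighbors K o)).ncard : ℝ) ≤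
        1 + ({v | v ∈ neighbors K o ∧ v.1 ∈ W}.ncard : ℝ) := by
    intro s hs
    have h1 : s ∩ insert o (neighbors K o) ⊆ insert o {v | v ∈ neighbors K o ∧ v.1 ∈ W} := by
      rintro v ⟨hv, rfl | hv'⟩
      · exact Or.inl rfl
      · exact Or.inr ⟨hv', hs v hv⟩
    have h2 := (Set.ncard_le_ncard h1 (hN.insert o)).trans (Set.ncard_insert_le _ _)
    have h3 : ((s ∩ insert o (neighbors K o)).ncard : ℝ) ≤
      (({v | v ∈ neighbors K o ∧ v.1 ∈ W}.ncard + 1 : ℕ) : ℝ) := by exact_mod_cast h2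
    push_cast at h3
    linarith
  have h1 := key (degreeSet m l (restrictTo K W)) fun v hv => (mem_vertices_restrictTo.1 hv.1).2
  have h2 := key (degreeSet m l (restrictTo K (W \ {o.1})))
    fun v hv => (mem_vertices_restrictTo.1 hv.1).2.1
  rw [abs_le]
  constructor
  · have : (0 : ℝ) ≤ (degreeSet m l (restrictTo K W) ∩ insert o (neighbors K o)).ncard :=
      Nat.cast_nonneg _
    linarith
  · have : (0 : ℝ) ≤ (degreeSet m l (restrictTo K (W \ {o.1})) ∩
      insert o (neighbors K o)).ncard := Nat.cast_nonneg _
    linarith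

theorem isBounded_fst_of_finite {S : Set (Finset (Space d × A))} (hS : S.Finite) :
    Bornology.IsBounded {x : Space d | ∃ σ ∈ S, ∃ v ∈ σ, v.1 = x} := by
  classical
  refine Set.Finite.isBounded ?_
  refine (hS.biUnion fun σ _ => (σ.image Prod.fst).finite_toSet).subset ?_
  rintro x ⟨σ, hσ, v, hv, rfl⟩
  exact Set.mem_biUnion hσ (by simpa using ⟨v.2, hv⟩)

/-- Whether a vertex has degree `l` in the restriction to `W` does not depend on `W` if `W` is
large. -/
theorem exists_degreeSet_stable (K : PreAbstractSimplicialComplex (Space d × A))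
    (hfin : ∀ W, Bornology.IsBounded W → (vertices (restrictTo K W)).Finite) (m l : ℕ)
    (v : Space d × A) : ∃ C : Set (Space d), Bornology.IsBounded C ∧ ∃ a : Prop,
      ∀ W, Bornology.IsBounded W → C ⊆ W → (v ∈ degreeSet m l (restrictTo K W) ↔ a) := by
  by_cases hv : v ∈ vertices K
  swap
  · exact ⟨∅, Bornology.isBounded_empty, False, fun W _ _ =>
      iff_of_false (fun h => hv (mem_vertices_restrictTo.1 h.1).1) id⟩
  set S := {σ | σ ∈ K.faces ∧ v ∈ σ ∧ σ.card = m + 1} with hS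
  -- If `v` lies in finitely many `m`-simplices, a region containing all of them fixes the degree.
  -- Otherwise `l + 1` of these simplices in the region already exclude degree `l`.
  by_cases hSf : S.Finite
  · refine ⟨insert v.1 {x : Space d | ∃ σ ∈ S, ∃ v ∈ σ, v.1 = x},
      (isBounded_fst_of_finite hSf).insert _, S.ncard = l, fun W _ hW => ?_⟩
    have hvW : v ∈ vertices (restrictTo K W) :=
      mem_vertices_restrictTo.2 ⟨hv, hW (Set.mem_insert _ _)⟩
    have hd : simplexDegree m v (restrictTo K W) = S.ncard := by
      rw [simplexDegree]
      congr 1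
      ext σ
      exact ⟨fun h => ⟨h.1.1, h.2⟩, fun h => ⟨⟨h.1, fun w hw =>
        hW (Set.mem_insert_of_mem _ ⟨σ, h, w, hw, rfl⟩)⟩, h.2⟩⟩
    rw [degreeSet, Set.mem_ofPred_eq, hd]
    exact and_iff_right hvW
  · obtain ⟨T, hTS, hTc⟩ := Set.Infinite.exists_subset_card_eq hSf (l + 1)
    refine ⟨{x : Space d | ∃ σ ∈ (T : Set (Finset (Space d × A))), ∃ v ∈ σ, v.1 = x},
      isBounded_fst_of_finite T.finite_toSet, False, fun W hWb hW => iff_of_false ?_ id⟩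
    rintro ⟨-, hd⟩
    have hsub : (T : Set (Finset (Space d × A))) ⊆
        {σ | σ ∈ (restrictTo K W).faces ∧ v ∈ σ ∧ σ.card = m + 1} := fun σ hσ =>
      ⟨⟨(hTS hσ).1, fun w hw => hW ⟨σ, hσ, w, hw, rfl⟩⟩, (hTS hσ).2⟩
    have h1 := Set.ncard_le_ncard hsub
      ((finite_faces_of_finite_vertices (hfin W hWb)).subset fun σ hσ => hσ.1)
    rw [Set.ncard_coe_finset, hTc] at h1
    rw [simplexDegree] at hd
    omega

theorem exists_degreeSet_inter_stable (K : PreAbstractSimplicialComplex (Space d × A))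
    (hfin : ∀ W, Bornology.IsBounded W → (vertices (restrictTo K W)).Finite) (m l : ℕ)
    {N : Set (Space d × A)} (hN : N.Finite) : ∃ C : Set (Space d), Bornology.IsBounded C ∧
      ∃ S : Set (Space d × A), ∀ W, Bornology.IsBounded W → C ⊆ W →
        degreeSet m l (restrictTo K W) ∩ N = S := by
  choose C hC a ha using exists_degreeSet_stable K hfin m l
  refine ⟨⋃ v ∈ N, C v, (Bornology.isBounded_biUnion hN).2 fun v _ => hC v, {v | a v ∧ v ∈ N},
    fun W hWb hW => ?_⟩
  ext v
  exact and_congr_left fun hv => ha v W hWb ((Set.subset_biUnion_of_mem hv).trans hW)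

/-- Restricting to `W` without the location of `o` is restricting to `W` the complex with `o`
deleted. Hence the same stabilization result applies to both counts, on the finite set formed by `o`
and its neighbours. -/
theorem exists_numVertices_sub_stable {K : PreAbstractSimplicialComplex (Space d × A)}
    {o : Space d × A} (ho : ∀ v ∈ vertices K, v.1 = o.1 → v = o)
    (hfin : ∀ W, Bornology.IsBounded W → (vertices (restrictTo K W)).Finite) (m l : ℕ)
    (hN : (neighbors K o).Finite) :
    ∃ C : Set (Space d), Bornology.IsBounded C ∧ ∃ c : ℝ, ∀ W, Bornology.IsBounded W → C ⊆ W →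
      numVerticesOfDegree m l (restrictTo K W) -
        numVerticesOfDegree m l (restrictTo K (W \ {o.1})) = c := by
  obtain ⟨C₁, hC₁, S₁, h₁⟩ := exists_degreeSet_inter_stable K hfin m l (hN.insert o)
  obtain ⟨C₂, hC₂, S₂, h₂⟩ := exists_degreeSet_inter_stable (restrictTo K {o.1}ᶜ)
    (fun W hW => by
      rw [restrictTo_restrictTo]
      exact hfin _ (hW.subset Set.inter_subset_left)) m l (hN.insert o)
  refine ⟨C₁ ∪ C₂, hC₁.union hC₂, S₁.ncard - S₂.ncard, fun W hWb hW => ?_⟩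
  have h3 := h₂ W hWb (Set.subset_union_right.trans hW)
  rw [restrictTo_restrictTo, ← Set.sdiff_eq] at h3
  rw [numVertices_sub_eq ho (hfin W hWb), h₁ W hWb (Set.subset_union_left.trans hW), h3]

end Difference


/-! ### The Poisson distribution -/

section PoissonLaw

variable {Ω : Type*} [MeasurableSpace Ω] {P : Measure Ω}

theorem poissonMeasure_two_le (r : ℝ≥0) : poissonMeasure r {n | 2 ≤ n} ≤ (r : ℝ≥0∞) ^ 2 := by
  have h0 : {n : ℕ | 2 ≤ n} = ({0} ∪ {1})ᶜ := by
    ext n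
    simp only [Set.mem_ofPred_eq, Set.mem_compl_iff, Set.mem_union, Set.mem_singleton_iff]
    omega
  rw [h0, ← ofReal_measureReal, probReal_compl_eq_one_sub (by measurability),
    measureReal_union (by simp) (by measurability), poissonMeasure_real_singleton,
    poissonMeasure_real_singleton, ← ENNReal.ofReal_coe_nnreal, ← ENNReal.ofReal_pow (NNReal.coe_nonneg r)]
  refine ENNReal.ofReal_le_ofReal ?_
  -- The probability is 1 - e^(-r)(1 + r), and e^(-r) ≥ 1 - r bounds it by 1 - (1 - r)(1 + r) = r².
  have h1 := Real.add_one_le_exp (-(r : ℝ))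
  have h2 : (0 : ℝ) ≤ r := r.2
  simp only [pow_zero, Nat.factorial_zero, pow_one, Nat.factorial_one, Nat.cast_one, div_one,
    mul_one]
  nlinarith

theorem lintegral_exp_poissonMeasure (r : ℝ≥0) (c : ℝ) :
    ∫⁻ n, ENNReal.ofReal (Real.exp (c * n)) ∂poissonMeasure r =
      ENNReal.ofReal (Real.exp (r * (Real.exp c - 1))) := by
  rw [lintegral_countable']
  have h1 : ∀ n : ℕ, ENNReal.ofReal (Real.exp (c * n)) * poissonMeasure r {n} =
      ENNReal.ofReal (Real.exp (-r) * ((r * Real.exp c) ^ n / n.factorial)) := by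
    intro n
    rw [← ofReal_measureReal, poissonMeasure_real_singleton,
      ← ENNReal.ofReal_mul (Real.exp_pos _).le]
    congr 1
    rw [mul_pow, ← Real.exp_nat_mul, mul_comm c]
    ring
  have h2 : HasSum (fun n : ℕ => Real.exp (-r) * ((r * Real.exp c) ^ n / n.factorial))
      (Real.exp (-r) * Real.exp (r * Real.exp c)) := by
    refine HasSum.mul_left _ ?_
    rw [Real.exp_eq_exp_ℝ]
    exact NormedSpace.expSeries_div_hasSum_exp _
  rw [tsum_congr h1, ← ENNReal.ofReal_tsum_of_nonneg (fun n => by positivity) h2.summable,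
    h2.tsum_eq, ← Real.exp_add]
  congr 2
  ring

theorem measure_two_le_of_poissonLaw {N : Ω → ℝ≥0∞} (hN : Measurable N) {r : ℝ≥0∞}
    (h : P.map N = poissonLaw r) : P {ω | 2 ≤ N ω} ≤ r ^ 2 := by
  by_cases hr : r = ∞
  · simp [hr]
  have h1 : P {ω | 2 ≤ N ω} = P.map N (Set.Ici 2) := (Measure.map_apply hN measurableSet_Ici).symm
  rw [h1, h, poissonLaw, if_neg hr, Measure.map_apply (by fun_prop) measurableSet_Ici]
  have h2 := poissonMeasure_two_le r.toNNReal
  rw [ENNReal.coe_toNNReal hr] at h2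
  convert h2 using 2
  ext n
  simp only [Set.mem_preimage, Set.mem_Ici, Set.mem_ofPred_eq]
  norm_cast

theorem lintegral_exp_of_poissonLaw {N : Ω → ℝ≥0∞} (hN : Measurable N) {r : ℝ≥0∞} (hr : r ≠ ∞)
    (h : P.map N = poissonLaw r) (c : ℝ) :
    ∫⁻ ω, ENNReal.ofReal (Real.exp (c * (N ω).toReal)) ∂P =
      ENNReal.ofReal (Real.exp (r.toReal * (Real.exp c - 1))) := by
  have hm : Measurable fun x : ℝ≥0∞ => ENNReal.ofReal (Real.exp (c * x.toReal)) :=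
    (Real.measurable_exp.comp (measurable_const.mul ENNReal.measurable_toReal)).ennreal_ofReal
  rw [← lintegral_map (μ := P) hm hN, h, poissonLaw, if_neg hr, lintegral_map hm (by fun_prop)]
  simpa using! lintegral_exp_poissonMeasure r.toNNReal c

theorem ae_eq_zero_of_poissonLaw {N : Ω → ℝ≥0∞} (hN : Measurable N)
    (h : P.map N = poissonLaw 0) : ∀ᵐ ω ∂P, N ω = 0 := by
  have h1 : P {ω | N ω ≠ 0} = P.map N {0}ᶜ :=
    (Measure.map_apply hN (measurableSet_singleton 0).compl).symm
  have h2 : poissonMeasure 0 {0}ᶜ = 0 := by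
    rw [← ofReal_measureReal, probReal_compl_eq_one_sub (by measurability),
      poissonMeasure_real_singleton]
    simp
  rw [ae_iff, h1, h, poissonLaw, if_neg ENNReal.zero_ne_top, Measure.map_apply (by fun_prop)
    (measurableSet_singleton 0).compl]
  have h3 : (fun n : ℕ => (n : ℝ≥0∞)) ⁻¹' {0}ᶜ = {0}ᶜ := by
    ext n
    simp
  rw [h3]
  exact h2

/-- Convexity: the exponential lies below its chord between `0` and `c`. -/
theorem exp_mul_sub_one_le {t : ℝ} (h0 : 0 ≤ t) (h1 : t ≤ 1) (c : ℝ) :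
    Real.exp (c * t) - 1 ≤ t * (Real.exp c - 1) := by
  have := convexOn_exp.2 (Set.mem_univ c) (Set.mem_univ 0) h0 (sub_nonneg.2 h1) (by ring)
  simp only [smul_eq_mul, mul_zero, add_zero, Real.exp_zero, mul_one] at this
  rw [mul_comm c]
  linarith

end PoissonLaw

/-! ### Exponential moments of Poisson integrals -/

section Exponential

variable {d : ℕ} {S Ω : Type*} [MeasurableSpace S] [MeasurableSpace Ω] {P : Measure Ω}
  {Ψ : Ω → Measure (Space d × S)} {μ : Measure (Space d × S)}

theorem IsPoissonProcess.measurable_apply (h : IsPoissonProcess P Ψ μ) {B : Set (Space d × S)}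
    (hB : MeasurableSet B) : Measurable fun ω => Ψ ω B :=
  (Measure.measurable_coe hB).comp h.measurable

/-- The part of `D` where `g` lies in `((i - 1) / n, i / n]`. -/
def levelSet (D : Set (Space d × S)) (g : Space d × S → ℝ) (n : ℕ) (i : Fin (n + 1)) :
    Set (Space d × S) :=
  {p | p ∈ D ∧ ⌈n * g p⌉₊ = i}

theorem measurableSet_levelSet {D : Set (Space d × S)} (hD : MeasurableSet D)
    {g : Space d × S → ℝ} (hg : Measurable g) (n : ℕ) (i : Fin (n + 1)) :
    MeasurableSet (levelSet D g n i) :=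
  hD.inter ((Nat.measurable_ceil.comp (measurable_const.mul hg)) (measurableSet_singleton (i : ℕ)))

theorem pairwise_disjoint_levelSet (D : Set (Space d × S)) (g : Space d × S → ℝ) (n : ℕ) :
    Pairwise fun i j => Disjoint (levelSet D g n i) (levelSet D g n j) := fun _ _ hij =>
  Set.disjoint_left.2 fun _ hp hq => hij (Fin.ext (hp.2.symm.trans hq.2))

theorem setLIntegral_eq_sum_levelSet {D : Set (Space d × S)} (hD : MeasurableSet D)
    {g : Space d × S → ℝ} (hg : Measurable g) (hg1 : ∀ p, g p ≤ 1) (n : ℕ)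
    (ν : Measure (Space d × S)) (f : Space d × S → ℝ≥0∞) :
    ∫⁻ p in D, f p ∂ν = ∑ i, ∫⁻ p in levelSet D g n i, f p ∂ν := by
  have hU : D = ⋃ i, levelSet D g n i := by
    ext p
    simp only [levelSet, Set.mem_iUnion, Set.mem_ofPred_eq, exists_and_left, iff_self_and]
    intro _
    refine ⟨⟨⌈n * g p⌉₊, Nat.lt_succ_of_le (Nat.ceil_le.2 ?_)⟩, rfl⟩
    exact mul_le_of_le_one_right (Nat.cast_nonneg n) (hg1 p)
  conv_lhs => rw [hU]
  rw [lintegral_iUnion (measurableSet_levelSet hD hg n) (pairwise_disjoint_levelSet D g n),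
    tsum_fintype]

/-- The right side integrates `g` rounded up to a multiple of `1 / n`. Such a step function has as
its Poisson integral a combination of independent Poisson variables. -/
theorem setLIntegral_le_sum_levelSet {D : Set (Space d × S)} (hD : MeasurableSet D)
    {g : Space d × S → ℝ} (hg : Measurable g) (hg1 : ∀ p, g p ≤ 1) {n : ℕ} (hn : 0 < n)
    (ν : Measure (Space d × S)) :
    ∫⁻ p in D, ENNReal.ofReal (g p) ∂ν ≤
      ∑ i : Fin (n + 1), ENNReal.ofReal (i / n) * ν (levelSet D g n i) := by
  rw [setLIntegral_eq_sum_levelSet hD hg hg1 n]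
  refine Finset.sum_le_sum fun i _ => ?_
  rw [← setLIntegral_const]
  refine setLIntegral_mono' (measurableSet_levelSet hD hg n i) fun p hp =>
    ENNReal.ofReal_le_ofReal ?_
  rw [le_div_iff₀ (by exact_mod_cast hn), ← hp.2, mul_comm]
  exact Nat.le_ceil _

/-- Rounding up costs at most `1 / n` at each point of `D`. -/
theorem sum_levelSet_le_setLIntegral {D : Set (Space d × S)} (hD : MeasurableSet D)
    {g : Space d × S → ℝ} (hg : Measurable g) (hg0 : ∀ p, 0 ≤ g p) (hg1 : ∀ p, g p ≤ 1)
    {n : ℕ} (hn : 0 < n) (ν : Measure (Space d × S)) :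
    ∑ i : Fin (n + 1), ENNReal.ofReal (i / n) * ν (levelSet D g n i) ≤
      ∫⁻ p in D, ENNReal.ofReal (g p) ∂ν + ENNReal.ofReal (1 / n) * ν D := by
  have hn' : (0 : ℝ) < n := by exact_mod_cast hn
  rw [← setLIntegral_const, ← lintegral_add_left hg.ennreal_ofReal,
    setLIntegral_eq_sum_levelSet hD hg hg1 n]
  refine Finset.sum_le_sum fun i _ => ?_
  rw [← setLIntegral_const]
  refine setLIntegral_mono' (measurableSet_levelSet hD hg n i) fun p hp => ?_
  rw [← ENNReal.ofReal_add (hg0 p) (by positivity)]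
  refine ENNReal.ofReal_le_ofReal ?_
  rw [div_le_iff₀ hn', ← hp.2, add_mul, one_div_mul_cancel hn'.ne', mul_comm (g p)]
  exact (Nat.ceil_lt_add_one (mul_nonneg hn'.le (hg0 p))).le

/-- An upper bound for the exponential moments of the integral of a function with values in
`[0,1]`. -/
theorem IsPoissonProcess.lintegral_exp_le (h : IsPoissonProcess P Ψ μ) {D : Set (Space d × S)}
    (hD : MeasurableSet D) (hμ : μ D ≠ ∞) (hΨ : ∀ ω, Ψ ω D ≠ ∞)
    {g : Space d × S → ℝ} (hg : Measurable g) (hg0 : ∀ p, 0 ≤ g p) (hg1 : ∀ p, g p ≤ 1)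
    {c : ℝ} (hc : 0 ≤ c) :
    ∫⁻ ω, ENNReal.ofReal (Real.exp (c * (∫⁻ p in D, ENNReal.ofReal (g p) ∂Ψ ω).toReal)) ∂P ≤
      ENNReal.ofReal (Real.exp ((Real.exp c - 1) *
        (∫⁻ p in D, ENNReal.ofReal (g p) ∂μ).toReal)) := by
  have hsub : ∀ (n : ℕ) (i : Fin (n + 1)), levelSet D g n i ⊆ D := fun n i p hp => hp.1
  have hint : ∀ ν : Measure (Space d × S), ν D ≠ ∞ → ∫⁻ p in D, ENNReal.ofReal (g p) ∂ν ≠ ∞ := by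
    intro ν hν
    refine ne_top_of_le_ne_top hν ?_
    rw [← setLIntegral_one]
    exact setLIntegral_mono' hD fun p _ => ENNReal.ofReal_le_one.2 (hg1 p)
  have hec : 0 ≤ Real.exp c - 1 := sub_nonneg.2 (Real.one_le_exp hc)
  -- Bound the integral by that of the rounded function, factorize over the level sets by
  -- independence, and insert the Poisson generating function. Convexity then makes each exponent
  -- linear in the level `i / n`, and the rounding error vanishes as `n` grows.
  have key : ∀ n : ℕ, 0 < n →
      ∫⁻ ω, ENNReal.ofReal (Real.exp (c * (∫⁻ p in D, ENNReal.ofReal (g p) ∂Ψ ω).toReal)) ∂P ≤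
      ENNReal.ofReal (Real.exp ((Real.exp c - 1) *
        ((∫⁻ p in D, ENNReal.ofReal (g p) ∂μ).toReal + 1 / n * (μ D).toReal))) := by
    intro n hn
    have hn' : (0 : ℝ) < n := by exact_mod_cast hn
    have htop : ∀ ν : Measure (Space d × S), ν D ≠ ∞ → ∀ i : Fin (n + 1),
        ν (levelSet D g n i) ≠ ∞ := fun ν hν i => ne_top_of_le_ne_top hν (measure_mono (hsub n i))
    have hsum : ∀ ν : Measure (Space d × S), ν D ≠ ∞ →
        (∑ i : Fin (n + 1), ENNReal.ofReal (i / n) * ν (levelSet D g n i)).toReal =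
        ∑ i : Fin (n + 1), (i / n : ℝ) * (ν (levelSet D g n i)).toReal := by
      intro ν hν
      rw [ENNReal.toReal_sum fun i _ => ENNReal.mul_ne_top ENNReal.ofReal_ne_top (htop ν hν i)]
      refine Finset.sum_congr rfl fun i _ => ?_
      rw [ENNReal.toReal_mul, ENNReal.toReal_ofReal (by positivity)]
    have hsumtop : ∀ ν : Measure (Space d × S), ν D ≠ ∞ →
        ∑ i : Fin (n + 1), ENNReal.ofReal (i / n) * ν (levelSet D g n i) ≠ ∞ := fun ν hν =>
      ENNReal.sum_ne_top.2 fun i _ => ENNReal.mul_ne_top ENNReal.ofReal_ne_top (htop ν hν i)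
    set X : Fin (n + 1) → Ω → ℝ≥0∞ := fun i ω =>
      ENNReal.ofReal (Real.exp (c * (i / n) * (Ψ ω (levelSet D g n i)).toReal)) with hX
    have hmeas : ∀ i, Measurable fun x : ℝ≥0∞ =>
        ENNReal.ofReal (Real.exp (c * ((i : Fin (n + 1)) / n) * x.toReal)) := fun i =>
      (Real.measurable_exp.comp (measurable_const.mul ENNReal.measurable_toReal)).ennreal_ofReal
    have hXm : ∀ i, Measurable (X i) := fun i =>
      (hmeas i).comp (h.measurable_apply (measurableSet_levelSet hD hg n i))
    have hXi : iIndepFun X P := (h.indep (n + 1) (levelSet D g n)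
      (measurableSet_levelSet hD hg n) (pairwise_disjoint_levelSet D g n)).comp
      (fun i x => ENNReal.ofReal (Real.exp (c * ((i : Fin (n + 1)) / n) * x.toReal))) hmeas
    calc ∫⁻ ω, ENNReal.ofReal (Real.exp (c * (∫⁻ p in D, ENNReal.ofReal (g p) ∂Ψ ω).toReal)) ∂P
        ≤ ∫⁻ ω, ∏ i, X i ω ∂P := by
          refine lintegral_mono fun ω => ?_
          rw [hX, ← ENNReal.ofReal_prod_of_nonneg fun i _ => (Real.exp_pos _).le, ← Real.exp_sum]
          refine ENNReal.ofReal_le_ofReal (Real.exp_le_exp.2 ?_)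
          have h1 := ENNReal.toReal_mono (hsumtop _ (hΨ ω))
            (setLIntegral_le_sum_levelSet hD hg hg1 hn (Ψ ω))
          rw [hsum _ (hΨ ω)] at h1
          refine (mul_le_mul_of_nonneg_left h1 hc).trans_eq ?_
          rw [Finset.mul_sum]
          exact Finset.sum_congr rfl fun i _ => by ring
      _ = ∏ i, ∫⁻ ω, X i ω ∂P := lintegral_prod_eq_prod_lintegral_of_indepFun _ X hXi hXm
      _ = ∏ i : Fin (n + 1), ENNReal.ofReal (Real.exp ((μ (levelSet D g n i)).toReal *
            (Real.exp (c * (i / n)) - 1))) := by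
          refine Finset.prod_congr rfl fun i _ => ?_
          exact lintegral_exp_of_poissonLaw (h.measurable_apply (measurableSet_levelSet hD hg n i))
            (htop μ hμ i) (h.law _ (measurableSet_levelSet hD hg n i)) _
      _ ≤ _ := by
          rw [← ENNReal.ofReal_prod_of_nonneg fun i _ => (Real.exp_pos _).le, ← Real.exp_sum]
          refine ENNReal.ofReal_le_ofReal (Real.exp_le_exp.2 ?_)
          have h1 := ENNReal.toReal_mono (ENNReal.add_ne_top.2 ⟨hint μ hμ,
            ENNReal.mul_ne_top ENNReal.ofReal_ne_top hμ⟩)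
            (sum_levelSet_le_setLIntegral hD hg hg0 hg1 hn μ)
          rw [hsum _ hμ, ENNReal.toReal_add (hint μ hμ)
            (ENNReal.mul_ne_top ENNReal.ofReal_ne_top hμ), ENNReal.toReal_mul,
            ENNReal.toReal_ofReal (by positivity)] at h1
          refine le_trans ?_ (mul_le_mul_of_nonneg_left h1 hec)
          rw [Finset.mul_sum]
          refine Finset.sum_le_sum fun i _ => ?_
          have h2 : (i : ℝ) / n ≤ 1 := by
            rw [div_le_one hn']
            exact_mod_cast Nat.lt_succ_iff.1 i.2
          have h3 := mul_le_mul_of_nonneg_left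
            (exp_mul_sub_one_le (by positivity : (0 : ℝ) ≤ (i : ℝ) / n) h2 c)
            (ENNReal.toReal_nonneg (a := μ (levelSet D g n i)))
          linarith
  have hlim : Tendsto (fun n : ℕ => ENNReal.ofReal (Real.exp ((Real.exp c - 1) *
      ((∫⁻ p in D, ENNReal.ofReal (g p) ∂μ).toReal + 1 / (n : ℝ) * (μ D).toReal)))) atTop
      (𝓝 (ENNReal.ofReal (Real.exp ((Real.exp c - 1) *
        ((∫⁻ p in D, ENNReal.ofReal (g p) ∂μ).toReal + 0 * (μ D).toReal))))) := by
    refine ENNReal.tendsto_ofReal ((Real.continuous_exp.tendsto _).comp ?_)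
    exact ((tendsto_one_div_atTop_nhds_zero_nat.mul_const _).const_add _).const_mul _
  rw [zero_mul, add_zero] at hlim
  exact ge_of_tendsto hlim (eventually_atTop.2 ⟨1, fun n hn => key n hn⟩)

/-- If the intensity measure of thin slices is small, then almost surely no slice contains two
points. -/
theorem IsPoissonProcess.ae_measure_fiber_le_one (h : IsPoissonProcess P Ψ μ)
    {D : Set (Space d × S)} (hD : MeasurableSet D) {f : Space d × S → ℝ} (hf : Measurable f)
    (M : ℕ) (hfD : ∀ p ∈ D, 0 ≤ f p ∧ f p < M) (C : ℝ≥0∞) (hC : C ≠ ∞)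
    (hsmall : ∀ n : ℕ, 0 < n → ∀ i : ℕ,
      μ {p | p ∈ D ∧ f p ∈ Set.Ico ((i : ℝ) / n) ((i + 1) / n)} ≤ C / n) :
    ∀ᵐ ω ∂P, ∀ x, Ψ ω {p | p ∈ D ∧ f p = x} ≤ 1 := by
  have hm : ∀ n i : ℕ, MeasurableSet {p | p ∈ D ∧ f p ∈ Set.Ico ((i : ℝ) / n) ((i + 1) / n)} :=
    fun n i => hD.inter (hf measurableSet_Ico)
  -- Two points on one fibre lie in one of `M * n` slices of width `1 / n`. Each slice holds two
  -- points with probability at most `(C / n) ^ 2`, so the total tends to zero.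
  have key : ∀ n : ℕ, 0 < n → P {ω | ¬ ∀ x, Ψ ω {p | p ∈ D ∧ f p = x} ≤ 1} ≤
      (M * C ^ 2) / n := by
    intro n hn
    have hn' : (0 : ℝ) < n := by exact_mod_cast hn
    have hsub : {ω | ¬ ∀ x, Ψ ω {p | p ∈ D ∧ f p = x} ≤ 1} ⊆ ⋃ i ∈ Finset.range (M * n),
        {ω | 2 ≤ Ψ ω {p | p ∈ D ∧ f p ∈ Set.Ico ((i : ℝ) / n) ((i + 1) / n)}} := by
      intro ω hω
      obtain ⟨x, hx⟩ := not_forall.1 hω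
      rw [not_le] at hx
      have hx2 : 2 ≤ Ψ ω {p | p ∈ D ∧ f p = x} := by
        have hmx : MeasurableSet {p | p ∈ D ∧ f p = x} := hD.inter (hf (measurableSet_singleton x))
        rcases (h.locallyFiniteCounting ω).counting _ hmx with h' | ⟨k, hk⟩
        · simp [h']
        · rw [hk] at hx ⊢
          have : 1 < k := by exact_mod_cast hx
          exact_mod_cast this
      obtain ⟨p, hp⟩ : {p | p ∈ D ∧ f p = x}.Nonempty := by
        rw [Set.nonempty_iff_ne_empty]
        intro h0
        rw [h0, measure_empty] at hx
        simp at hx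
      obtain ⟨hp0, hpM⟩ := hfD p hp.1
      rw [hp.2] at hp0 hpM
      simp only [Set.mem_iUnion, Finset.mem_range]
      refine ⟨⌊x * n⌋₊, ?_, hx2.trans (measure_mono fun q hq => ⟨hq.1, ?_⟩)⟩
      · rw [Nat.floor_lt (by positivity)]
        push_cast
        exact mul_lt_mul_of_pos_right hpM hn'
      · rw [hq.2]
        exact ⟨(div_le_iff₀ hn').2 (Nat.floor_le (by positivity)),
          (lt_div_iff₀ hn').2 (Nat.lt_floor_add_one _)⟩
    have hn0 : (n : ℝ≥0∞) ≠ 0 := by exact_mod_cast hn.ne'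
    calc _ ≤ ∑ i ∈ Finset.range (M * n), P {ω | 2 ≤ Ψ ω {p | p ∈ D ∧
            f p ∈ Set.Ico ((i : ℝ) / n) ((i + 1) / n)}} :=
          (measure_mono hsub).trans (measure_biUnion_finset_le _ _)
      _ ≤ ∑ i ∈ Finset.range (M * n), (C / n) ^ 2 := Finset.sum_le_sum fun i _ =>
          (measure_two_le_of_poissonLaw (h.measurable_apply (hm n i)) (h.law _ (hm n i))).trans
            (pow_le_pow_left' (hsmall n hn i) 2)
      _ = (M * C ^ 2) / n := by
          rw [Finset.sum_const, Finset.card_range, nsmul_eq_mul]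
          push_cast
          rw [ENNReal.div_eq_inv_mul, ENNReal.div_eq_inv_mul, mul_pow, pow_two (n : ℝ≥0∞)⁻¹]
          calc (M : ℝ≥0∞) * n * ((n : ℝ≥0∞)⁻¹ * (n : ℝ≥0∞)⁻¹ * C ^ 2)
              = (n * (n : ℝ≥0∞)⁻¹) * ((n : ℝ≥0∞)⁻¹ * (M * C ^ 2)) := by ring
            _ = _ := by rw [ENNReal.mul_inv_cancel hn0 (ENNReal.natCast_ne_top n), one_mul]
  rw [ae_iff]
  have hlim : Tendsto (fun n : ℕ => (M * C ^ 2) / (n : ℝ≥0∞)) atTop (𝓝 0) := by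
    have := ENNReal.Tendsto.const_div (a := M * C ^ 2) ENNReal.tendsto_nat_nhds_top
      (Or.inr (by finiteness))
    rwa [ENNReal.div_top] at this
  exact le_antisymm (ge_of_tendsto hlim (eventually_atTop.2 ⟨1, fun n hn => key n hn⟩)) zero_le

end Exponential


/-! ### Almost sure properties of the Poisson process -/

section Intensity

variable {d : ℕ} {A : Type*} {α : ℕ} [MeasurableSpace A]

instance isProbabilityMeasure_decisionLaw : IsProbabilityMeasure (decisionLaw α) := by
  unfold decisionLaw
  infer_instance

theorem intensity_slice (γ : ℝ≥0) (Θ : Measure A) [IsProbabilityMeasure Θ] (B : Set (Space d))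
    (J : Set unitInterval) :
    intensity d α γ Θ {p | p.1 ∈ B ∧ p.time ∈ J} = γ * volume B * volume J := by
  have h1 : {p : MarkedPoint d A α | p.1 ∈ B ∧ p.time ∈ J} =
      B ×ˢ (Set.univ ×ˢ (J ×ˢ Set.univ)) := by
    ext p
    simp [MarkedPoint.time]
  rw [h1, intensity, Measure.prod_prod, Measure.prod_prod, Measure.prod_prod]
  rw [measure_univ, measure_univ, one_mul, mul_one, Measure.smul_apply, ENNReal.smul_def,
    smul_eq_mul]

theorem intensity_fst (γ : ℝ≥0) (Θ : Measure A) [IsProbabilityMeasure Θ] (B : Set (Space d)) :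
    intensity d α γ Θ {p | p.1 ∈ B} = γ * volume B := by
  have := intensity_slice (α := α) γ Θ B Set.univ
  simpa using this

theorem volume_unitInterval_preimage_le (s : Set ℝ) (hs : MeasurableSet s) :
    volume {t : unitInterval | (t : ℝ) ∈ s} ≤ volume s := by
  have := (unitInterval.measurePreserving_coe.measure_preimage hs.nullMeasurableSet).le
  exact this.trans (Measure.restrict_apply_le _ _)

/-- The ball is enclosed in a cube of side `2 * k`, whose `i`-th side is replaced by `s`. The bound
is linear in the measure of `s`, as the slicing argument requires. -/
theorem volume_slab_le (i : Fin d) (k : ℕ) (s : Set ℝ) (hs : MeasurableSet s) :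
    volume {x : Space d | x ∈ Metric.ball 0 (k : ℝ) ∧ x i ∈ s} ≤
      ENNReal.ofReal (2 * k) ^ (d - 1) * volume s := by
  have hsub : {x : Space d | x ∈ Metric.ball 0 (k : ℝ) ∧ x i ∈ s} ⊆
      (WithLp.ofLp : Space d → (Fin d → ℝ)) ⁻¹'
        (Set.univ.pi (Function.update (fun _ => Set.Icc (-(k : ℝ)) k) i s)) := by
    rintro x ⟨hx, hxi⟩
    rw [Set.mem_preimage, Set.mem_univ_pi]
    intro j
    by_cases hj : j = i
    · subst hj
      simpa using hxi
    · rw [Function.update_of_ne hj, Set.mem_Icc, ← abs_le]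
      have h1 := PiLp.norm_apply_le x j
      rw [mem_ball_zero_iff] at hx
      exact (h1.trans hx.le)
  have hm : MeasurableSet (Set.univ.pi (Function.update (fun _ : Fin d => Set.Icc (-(k : ℝ)) k)
      i s)) := by
    refine MeasurableSet.univ_pi fun j => ?_
    by_cases hj : j = i
    · subst hj
      simpa using hs
    · rw [Function.update_of_ne hj]
      exact measurableSet_Icc
  refine (measure_mono hsub).trans ?_
  rw [(PiLp.volume_preserving_ofLp (Fin d)).measure_preimage hm.nullMeasurableSet, volume_pi_pi]
  have h2 : ∀ j, volume (Function.update (fun _ : Fin d => Set.Icc (-(k : ℝ)) k) i s j) =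
      Function.update (fun _ => volume (Set.Icc (-(k : ℝ)) k)) i (volume s) j := fun j =>
    Function.apply_update (fun _ => volume) _ _ _ _
  simp_rw [h2]
  rw [Finset.prod_update_of_mem (Finset.mem_univ i), mul_comm, Finset.prod_const, Real.volume_Icc]
  have h3 : (Finset.univ \ {i} : Finset (Fin d)).card = d - 1 := by
    rw [Finset.card_sdiff_of_subset (Finset.subset_univ _)]
    simp
  rw [h3, sub_neg_eq_add, two_mul]

end Intensity

/-! ### Simplicity of the process and insertion of an extra point -/

section AlmostSure

variable {d : ℕ} {A Ω : Type*} {α : ℕ} [MeasurableSpace A] [StandardBorelSpace A]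
  [MeasurableSpace Ω] {P : Measure Ω} {Θ : Measure A} [IsProbabilityMeasure Θ] {γ : ℝ≥0}
  {Ψ : Ω → Measure (MarkedPoint d A α)}

theorem ae_time_fiber_le_one (hΨ : IsPoissonProcess P Ψ (intensity d α γ Θ)) (k : ℕ) :
    ∀ᵐ ω ∂P, ∀ x : ℝ, Ψ ω {p : MarkedPoint d A α |
      p ∈ {p : MarkedPoint d A α | p.1 ∈ Metric.ball 0 (k : ℝ)} ∧ (p.time : ℝ) = x} ≤ 1 := by
  refine hΨ.ae_measure_fiber_le_one (measurableSet_fst_preimage Metric.isOpen_ball.measurableSet)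
    -- The bound must be strict and the time may equal one, hence `2`.
    (measurable_subtype_coe.comp measurable_time) 2
    (fun (p : MarkedPoint d A α) _ => ⟨p.time.2.1, p.time.2.2.trans_lt (by norm_num)⟩)
    (γ * volume (Metric.ball (0 : Space d) k))
    (ENNReal.mul_ne_top ENNReal.coe_ne_top measure_ball_lt_top.ne) fun n hn i => ?_
  have hn' : (0 : ℝ) < n := by exact_mod_cast hn
  have h1 := intensity_slice (α := α) γ Θ (Metric.ball (0 : Space d) k)
    {t | (t : ℝ) ∈ Set.Ico ((i : ℝ) / n) ((i + 1) / n)}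
  refine (le_of_eq h1).trans ?_
  rw [ENNReal.div_eq_inv_mul, mul_comm]
  refine mul_le_mul_left ((volume_unitInterval_preimage_le _ measurableSet_Ico).trans ?_) _
  rw [Real.volume_Ico, ← sub_div, add_sub_cancel_left, ENNReal.ofReal_div_of_pos hn']
  simp

/-- One coordinate is enough to separate locations. The shift by `k` moves its values on the ball
into `[0, 2 * k)`. -/
theorem ae_location_fiber_le_one (hΨ : IsPoissonProcess P Ψ (intensity d α γ Θ)) (i₀ : Fin d)
    (k : ℕ) : ∀ᵐ ω ∂P, ∀ x : ℝ,
      Ψ ω {p | p ∈ {p | p.1 ∈ Metric.ball 0 (k : ℝ)} ∧ p.1 i₀ + k = x} ≤ 1 := by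
  have hi₀ : Measurable fun p : MarkedPoint d A α => p.1 i₀ :=
    ((EuclideanSpace.proj (𝕜 := ℝ) i₀).continuous.measurable).comp measurable_fst
  refine hΨ.ae_measure_fiber_le_one (measurableSet_fst_preimage Metric.isOpen_ball.measurableSet)
    (hi₀.add_const _) (2 * k) (fun p hp => ?_)
    (γ * ENNReal.ofReal (2 * k) ^ (d - 1))
    (ENNReal.mul_ne_top ENNReal.coe_ne_top (by finiteness)) fun n hn i => ?_
  · have h1 := PiLp.norm_apply_le p.1 i₀
    have h2 : ‖p.1‖ < k := by simpa using hp
    have h3 := abs_lt.1 (h1.trans_lt h2)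
    push_cast
    constructor <;> linarith [h3.1, h3.2]
  · have hn' : (0 : ℝ) < n := by exact_mod_cast hn
    have h1 := intensity_fst (α := α) γ Θ {x : Space d | x ∈ Metric.ball 0 (k : ℝ) ∧
      x i₀ ∈ Set.Ico ((i : ℝ) / n - k) ((i + 1) / n - k)}
    have h2 : {p : MarkedPoint d A α | p ∈ {p : MarkedPoint d A α | p.1 ∈ Metric.ball 0 (k : ℝ)} ∧
        p.1 i₀ + k ∈ Set.Ico ((i : ℝ) / n) ((i + 1) / n)} =
        {p | p.1 ∈ {x : Space d | x ∈ Metric.ball 0 (k : ℝ) ∧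
          x i₀ ∈ Set.Ico ((i : ℝ) / n - k) ((i + 1) / n - k)}} := by
      ext p
      simp only [Set.mem_ofPred_eq, Set.mem_Ico, sub_le_iff_le_add, lt_sub_iff_add_lt]
    rw [h2, h1, ENNReal.div_eq_inv_mul, mul_comm (n : ℝ≥0∞)⁻¹, mul_assoc]
    refine mul_le_mul_right ((volume_slab_le i₀ k _ measurableSet_Ico).trans ?_) _
    refine mul_le_mul_right ?_ _
    rw [Real.volume_Ico, sub_sub_sub_cancel_right, ← sub_div, add_sub_cancel_left,
      ENNReal.ofReal_div_of_pos hn']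
    simp

/-- Two different points with equal values lie in a common ball and would give a fibre there mass at
least two. -/
theorem injOn_of_fiber_le_one {ψ : Measure (MarkedPoint d A α)} (h : IsLocallyFiniteCounting ψ)
    {f : ℕ → MarkedPoint d A α → ℝ} (hf : ∀ k : ℕ, ∀ x : ℝ,
      ψ {p | p ∈ {p | p.1 ∈ Metric.ball 0 (k : ℝ)} ∧ f k p = x} ≤ 1)
    {p q : MarkedPoint d A α} (hp : p ∈ points ψ) (hq : q ∈ points ψ)
    (hpq : ∀ k, f k p = f k q) : p = q := by
  classical
  by_contra hne
  obtain ⟨k, hk⟩ := exists_nat_gt (max ‖p.1‖ ‖q.1‖)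
  have h1 := h.card_le (s := {p, q}) (by
    intro r hr
    rcases Finset.mem_insert.1 (Finset.mem_coe.1 hr) with rfl | hr
    · exact hp
    · rw [Finset.mem_singleton.1 hr]
      exact hq)
  rw [Finset.card_pair hne] at h1
  have h2 : ((({p, q} : Finset (MarkedPoint d A α)) : Set (MarkedPoint d A α))) ⊆
      {r | r ∈ {r : MarkedPoint d A α | r.1 ∈ Metric.ball 0 (k : ℝ)} ∧ f k r = f k p} := by
    intro r hr
    rcases Finset.mem_insert.1 (Finset.mem_coe.1 hr) with rfl | hr
    · exact ⟨by simpa using (le_max_left _ _).trans_lt hk, rfl⟩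
    · rw [Finset.mem_singleton.1 hr]
      exact ⟨by simpa using (le_max_right _ _).trans_lt hk, (hpq k).symm⟩
  have h3 := h1.trans ((measure_mono h2).trans (hf k _))
  norm_num at h3

/-- Almost surely the points of the Poisson process have multiplicity one, different locations and
different ordering components. -/
theorem ae_isSimple (hd : 1 ≤ d) (hΨ : IsPoissonProcess P Ψ (intensity d α γ Θ)) :
    ∀ᵐ ω ∂P, IsSimple (Ψ ω) := by
  filter_upwards [ae_all_iff.2 fun k : ℕ => ae_time_fiber_le_one hΨ k,
    ae_all_iff.2 fun k : ℕ => ae_location_fiber_le_one hΨ ⟨0, hd⟩ k] with ω h1 h2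
  refine ⟨hΨ.locallyFiniteCounting ω, fun p => ?_, fun p hp q hq hpq => ?_,
    fun p hp q hq hpq => ?_⟩
  · obtain ⟨k, hk⟩ := exists_nat_gt ‖p.1‖
    refine (measure_mono ?_).trans (h1 k p.time)
    rintro q rfl
    exact ⟨by simpa using hk, rfl⟩
  · exact injOn_of_fiber_le_one (hΨ.locallyFiniteCounting ω) h1 hp hq
      fun _ => congrArg Subtype.val hpq
  · exact injOn_of_fiber_le_one (hΨ.locallyFiniteCounting ω) h2 hp hq
      fun k => congrArg (fun x : Space d => x ⟨0, hd⟩ + k) hpq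

/-- The point `p` can be added to a simple counting measure. -/
structure IsAddable (ψ : Measure (MarkedPoint d A α)) (p : MarkedPoint d A α) : Prop where
  simple : IsSimple ψ
  location_ne : ∀ q ∈ points ψ, q.1 ≠ p.1
  time_lt : ∀ q ∈ points ψ, q.time < p.time

/-- The location `0` and the time `1` each carry zero intensity. The exceptional null set does not
depend on `a` and `u`, so the random mark and decision can be substituted afterwards. -/
theorem ae_isAddable (hd : 1 ≤ d) (hΨ : IsPoissonProcess P Ψ (intensity d α γ Θ)) :
    ∀ᵐ ω ∂P, ∀ (a : A) (u : Decision α),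
      IsAddable (Ψ ω) ((0 : Space d), a, (1 : unitInterval), u) := by
  have : Nonempty (Fin d) := ⟨⟨0, hd⟩⟩
  have hm1 : MeasurableSet {p : MarkedPoint d A α | p.1 ∈ ({0} : Set (Space d))} :=
    measurableSet_fst_preimage (measurableSet_singleton _)
  have h1 : ∀ᵐ ω ∂P, Ψ ω {p | p.1 ∈ ({0} : Set (Space d))} = 0 := by
    refine ae_eq_zero_of_poissonLaw (hΨ.measurable_apply hm1) ?_
    have h := hΨ.law _ hm1
    rwa [intensity_fst, measure_singleton, mul_zero] at h
  have hm2 : MeasurableSet {p : MarkedPoint d A α |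
      p.1 ∈ (Set.univ : Set (Space d)) ∧ p.time ∈ ({1} : Set unitInterval)} :=
    (measurableSet_fst_preimage MeasurableSet.univ).inter
      (measurable_time (measurableSet_singleton _))
  have h2 : ∀ᵐ ω ∂P, Ψ ω {p | p.1 ∈ (Set.univ : Set (Space d)) ∧
      p.time ∈ ({1} : Set unitInterval)} = 0 := by
    refine ae_eq_zero_of_poissonLaw (hΨ.measurable_apply hm2) ?_
    have h := hΨ.law _ hm2
    rwa [intensity_slice, measure_singleton, mul_zero] at h
  filter_upwards [h1, h2, ae_isSimple hd hΨ] with ω h1 h2 h3 a u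
  refine ⟨h3, fun q hq hq0 => hq ?_, fun q hq => lt_of_le_of_ne ?_ fun hq1 => hq ?_⟩
  · exact measure_mono_null (Set.singleton_subset_iff.2 hq0) h1
  · exact q.time.2.2
  · exact measure_mono_null (Set.singleton_subset_iff.2
      (show q ∈ {p : MarkedPoint d A α | p.1 ∈ (Set.univ : Set (Space d)) ∧
        p.time ∈ ({1} : Set unitInterval)} from ⟨trivial, hq1⟩)) h2

theorem points_add_dirac (ψ : Measure (MarkedPoint d A α)) (p : MarkedPoint d A α) :
    points (ψ + Measure.dirac p) = insert p (points ψ) := by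
  ext q
  simp only [points, Set.mem_ofPred_eq, Set.mem_insert_iff, Measure.add_apply,
    Measure.dirac_apply' p (measurableSet_singleton q)]
  by_cases hqp : q = p
  · subst hqp
    simp
  · simp [hqp, Ne.symm hqp]

theorem IsLocallyFiniteCounting.add_dirac {ψ : Measure (MarkedPoint d A α)}
    (h : IsLocallyFiniteCounting ψ) (p : MarkedPoint d A α) :
    IsLocallyFiniteCounting (ψ + Measure.dirac p) := by
  classical
  constructor
  · intro B hB
    rw [Measure.add_apply, Measure.dirac_apply' p hB]
    rcases h.counting B hB with h' | ⟨n, hn⟩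
    · simp [h']
    · right
      refine ⟨n + if p ∈ B then 1 else 0, ?_⟩
      rw [hn]
      by_cases hp : p ∈ B <;> simp [hp]
  · intro B hB hBb
    rw [Measure.add_apply]
    exact ENNReal.add_lt_top.2 ⟨h.locallyFinite B hB hBb, measure_lt_top _ _⟩

theorem IsAddable.add_dirac {ψ : Measure (MarkedPoint d A α)} {p : MarkedPoint d A α}
    (h : IsAddable ψ p) : IsSimple (ψ + Measure.dirac p) := by
  refine ⟨h.simple.counting.add_dirac p, fun q => ?_, ?_, ?_⟩
  · rw [Measure.add_apply, Measure.dirac_apply' p (measurableSet_singleton q)]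
    by_cases hqp : p = q
    · subst hqp
      have : ψ {p} = 0 := by
        by_contra h0
        exact h.location_ne p h0 rfl
      simp [this]
    · simpa [hqp] using h.simple.le_one q
  · rw [points_add_dirac, Set.injOn_insert fun hp => h.location_ne p hp rfl]
    refine ⟨h.simple.time_inj, ?_⟩
    rintro ⟨q, hq, hqp⟩
    exact (h.time_lt q hq).ne hqp
  · rw [points_add_dirac, Set.injOn_insert fun hp => h.location_ne p hp rfl]
    refine ⟨h.simple.fst_inj, ?_⟩
    rintro ⟨q, hq, hqp⟩
    exact h.location_ne q hq hqp

/-- The new point is last in time, so it enters no set of earlier points and shifts no rank. -/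
theorem IsAddable.coordinates_eq {ψ : Measure (MarkedPoint d A α)} {p : MarkedPoint d A α}
    (h : IsAddable ψ p) (z : ℕ ≃ (Fin d → ℤ)) {q : MarkedPoint d A α} (hq : q ∈ points ψ) :
    coordinates z (ψ + Measure.dirac p) q = coordinates z ψ q := by
  simp only [coordinates, points_add_dirac]
  congr 2
  ext r
  simp only [Set.mem_ofPred_eq, Set.mem_insert_iff]
  constructor
  · rintro ⟨rfl | hr, h1, h2⟩
    · exact absurd h2 (not_le.2 (h.time_lt q hq))
    · exact ⟨hr, h1, h2⟩
  · rintro ⟨hr, h1, h2⟩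
    exact ⟨Or.inr hr, h1, h2⟩

theorem measurable_add_dirac : Measurable fun x : Config d A α × MarkedPoint d A α =>
    (⟨x.1.1 + Measure.dirac x.2, x.1.2.add_dirac x.2⟩ : Config d A α) :=
  Measurable.subtype_mk (by fun_prop)

end AlmostSure


/-! ### The degree of the added point -/

section OriginDegree

variable {d : ℕ} {A : Type*} {α : ℕ} [MeasurableSpace A] [StandardBorelSpace A]

/-- The index of the decision about the edge between a point with coordinates `c` and a later
point. -/
def edgeIndex (hα : 1 ≤ α) (c : ℕ × ℕ) : DecisionIndex α := ⟨⟨1, le_rfl, hα⟩, fun _ => c⟩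

theorem edgeIndex_injective (hα : 1 ≤ α) : Function.Injective (edgeIndex hα) := by
  intro c c' h
  rw [edgeIndex, edgeIndex, Sigma.mk.injEq] at h
  exact congrFun (eq_of_heq h.2) ⟨0, zero_lt_one⟩

/-- The probability of an edge between the origin with mark `a` and a point. -/
def edgeProb (φ : (j : ℕ) → (Fin (j + 1) → Space d × A) → ℝ) (a : A)
    (p : MarkedPoint d A α) : ℝ :=
  φ 1 ![((0 : Space d), a), p.vertex]

/-- The points in `W` that are connected with the origin with mark `a` and decision `u`. -/
def connectedSet (hα : 1 ≤ α) (z : ℕ ≃ (Fin d → ℤ))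
    (φ : (j : ℕ) → (Fin (j + 1) → Space d × A) → ℝ) (W : Set (Space d))
    (ψ : Measure (MarkedPoint d A α)) (a : A) (u : Decision α) : Set (MarkedPoint d A α) :=
  {p | p.1 ∈ W ∧ (u (edgeIndex hα (coordinatesAux z ψ p)) : ℝ) ≤ edgeProb φ a p}

theorem measurable_edgeProb {φ : (j : ℕ) → (Fin (j + 1) → Space d × A) → ℝ}
    (hφ : Measurable (φ 1)) :
    Measurable fun x : A × MarkedPoint d A α => edgeProb φ x.1 x.2 := by
  refine hφ.comp (measurable_pi_lambda _ fun i => ?_)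
  refine Fin.cases ?_ (fun i => ?_) i
  · exact (by fun_prop : Measurable fun x : A × MarkedPoint d A α => ((0 : Space d), x.1))
  · have : i = 0 := Subsingleton.elim _ _
    subst this
    exact measurable_vertex.comp measurable_snd

theorem measurable_edgeDecision (hα : 1 ≤ α) (z : ℕ ≃ (Fin d → ℤ)) :
    Measurable fun x : (Config d A α × A × Decision α) × MarkedPoint d A α =>
      x.1.2.2 (edgeIndex hα (coordinatesAux z x.1.1.1 x.2)) := by
  refine (measurable_decision_apply ⟨1, le_rfl, hα⟩).comp
    (Measurable.prodMk (by fun_prop) (measurable_pi_lambda _ fun _ => ?_))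
  exact (measurable_coordinatesAux z).comp
    (by fun_prop : Measurable fun x : (Config d A α × A × Decision α) × MarkedPoint d A α =>
      (x.1.1, x.2))

theorem measurableSet_connectedSet (hα : 1 ≤ α) (z : ℕ ≃ (Fin d → ℤ))
    {φ : (j : ℕ) → (Fin (j + 1) → Space d × A) → ℝ} (hφ : Measurable (φ 1))
    {W : Set (Space d)} (hW : MeasurableSet W) :
    MeasurableSet {x : (Config d A α × A × Decision α) × MarkedPoint d A α |
      x.2 ∈ connectedSet hα z φ W x.1.1.1 x.1.2.1 x.1.2.2} := by
  have h1 : MeasurableSet {x : (Config d A α × A × Decision α) × MarkedPoint d A α |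
      x.2.1 ∈ W} := measurable_snd.fst hW
  have h2 : MeasurableSet {x : (Config d A α × A × Decision α) × MarkedPoint d A α |
      (x.1.2.2 (edgeIndex hα (coordinatesAux z x.1.1.1 x.2)) : ℝ) ≤ edgeProb φ x.1.2.1 x.2} :=
    measurableSet_le (measurable_subtype_coe.comp (measurable_edgeDecision hα z))
      ((measurable_edgeProb hφ).comp (by fun_prop :
        Measurable fun x : (Config d A α × A × Decision α) × MarkedPoint d A α =>
          (x.1.2.1, x.2)))
  exact h1.inter h2

theorem measurable_measure_connectedSet (hα : 1 ≤ α) (z : ℕ ≃ (Fin d → ℤ))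
    {φ : (j : ℕ) → (Fin (j + 1) → Space d × A) → ℝ} (hφ : Measurable (φ 1))
    {W : Set (Space d)} (hW : MeasurableSet W) :
    Measurable fun x : Config d A α × A × Decision α =>
      x.1.1 (connectedSet hα z φ W x.1.1 x.2.1 x.2.2) :=
  measurable_config_measure (g := fun x : Config d A α × A × Decision α => x.1) measurable_fst
    (measurableSet_connectedSet hα z hφ hW)

/-- The neighbours of the added point are among the connected points. -/
theorem IsAddable.neighbors_subset (hα : 1 ≤ α) (z : ℕ ≃ (Fin d → ℤ))
    {φ : (j : ℕ) → (Fin (j + 1) → Space d × A) → ℝ} (hφ : IsConnectionFunction (φ 1))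
    {ψ : Measure (MarkedPoint d A α)} {a : A} {u : Decision α}
    (h : IsAddable ψ ((0 : Space d), a, (1 : unitInterval), u)) :
    neighbors (complex z φ (ψ + Measure.dirac ((0 : Space d), a, (1 : unitInterval), u)))
      ((0 : Space d), a) ⊆
      MarkedPoint.vertex '' {p | p ∈ points ψ ∧ p ∈ connectedSet hα z φ Set.univ ψ a u} := by
  rintro v ⟨hvo, σ, hσ, ho, hv⟩
  set o : MarkedPoint d A α := ((0 : Space d), a, (1 : unitInterval), u) with ho_def
  rw [mem_faces_complex] at hσ
  obtain ⟨-, -, hσp, hσc⟩ := hσ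
  obtain ⟨p, hp, rfl⟩ := hσp v hv
  rw [points_add_dirac, Set.mem_insert_iff] at hp
  rcases hp with rfl | hp
  · exact absurd rfl hvo
  refine ⟨p, ⟨hp, trivial, ?_⟩, rfl⟩
  -- The simplex condition is applied to the edge alone. The added point comes last, so the decision
  -- is read from its own component `u`.
  have h1 := hσc ⟨1, le_rfl, hα⟩ ![p, o] (by
    intro i
    rw [points_add_dirac]
    refine Fin.cases (Or.inr hp) (fun i => ?_) i
    have : i = 0 := Subsingleton.elim _ _
    subst this
    exact Or.inl rfl) (by
    intro i
    refine Fin.cases hv (fun i => ?_) i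
    have : i = 0 := Subsingleton.elim _ _
    subst this
    exact ho) (by
    rw [Fin.strictMono_iff_lt_succ]
    intro i
    have : i = 0 := Subsingleton.elim _ _
    subst this
    exact h.time_lt p hp)
  have h2 : decisionValue z (ψ + Measure.dirac o) ⟨1, le_rfl, hα⟩ ![p, o] =
      u (edgeIndex hα (coordinatesAux z ψ p)) := by
    rw [h.simple.coordinatesAux_eq, ← h.coordinates_eq z hp]
    simp only [decisionValue, edgeIndex]
    have h3 : (![p, o] (Fin.last 1)).decision = u := rfl
    have h4 : (fun i : Fin 1 => coordinates z (ψ + Measure.dirac o) (![p, o] i.castSucc)) =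
        fun _ => coordinates z (ψ + Measure.dirac o) p := by
      ext i : 1
      have : i = 0 := Subsingleton.elim _ _
      subst this
      rfl
    exact (congrArg (fun c => u (⟨⟨1, le_rfl, hα⟩, c⟩ : DecisionIndex α)) h4)
  have h5 : φ 1 (fun i => (![p, o] i).vertex) = edgeProb φ a p := by
    rw [edgeProb, ← hφ.symm (Equiv.swap 0 1)]
    congr 1
    ext i : 1
    fin_cases i <;> rfl
  rw [h2] at h1
  exact h1.trans_eq h5

theorem IsSimple.setLIntegral_eq_sum {ψ : Measure (MarkedPoint d A α)} (h : IsSimple ψ)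
    {W : Set (Space d)} (hW : MeasurableSet W) (hWb : Bornology.IsBounded W)
    (f : MarkedPoint d A α → ℝ≥0∞) :
    ∫⁻ p in {p | p.1 ∈ W}, f p ∂ψ = ∑ p ∈ (h.counting.finite_points hWb).toFinset, f p := by
  rw [← lintegral_indicator (measurableSet_fst_preimage hW), h.counting.lintegral_eq_tsum h.le_one,
    tsum_subtype (points ψ), tsum_eq_sum (s := (h.counting.finite_points hWb).toFinset)]
  · refine Finset.sum_congr rfl fun p hp => ?_
    rw [Set.Finite.mem_toFinset] at hp
    rw [Set.indicator_of_mem hp.1, Set.indicator_of_mem (show p ∈ {p : MarkedPoint d A α |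
      p.1 ∈ W} from hp.2)]
  · intro p hp
    rw [Set.Finite.mem_toFinset] at hp
    by_cases hp1 : p ∈ points ψ
    · rw [Set.indicator_of_mem hp1]
      have hp2 : p ∉ {p : MarkedPoint d A α | p.1 ∈ W} := fun hp2 => hp ⟨hp1, hp2⟩
      rw [Set.indicator_of_notMem hp2]
    · rw [Set.indicator_of_notMem hp1]

/-- The generating function of an indicator is 1 + (e^s - 1) times its probability, which is at most
`g`; then 1 + x ≤ e^x. -/
theorem lintegral_exp_indicator_le {s g : ℝ} (hs : 0 ≤ s) (hg : 0 ≤ g) :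
    ∫⁻ x : unitInterval, ENNReal.ofReal (Real.exp (s * {x : unitInterval | (x : ℝ) ≤ g}.indicator
      1 x)) ≤ ENNReal.ofReal (Real.exp ((Real.exp s - 1) * g)) := by
  have hm : MeasurableSet {x : unitInterval | (x : ℝ) ≤ g} :=
    measurableSet_le measurable_subtype_coe measurable_const
  have hes : 0 ≤ Real.exp s - 1 := sub_nonneg.2 (Real.one_le_exp hs)
  have h1 : ∀ x : unitInterval, ENNReal.ofReal (Real.exp (s * {x : unitInterval |
      (x : ℝ) ≤ g}.indicator 1 x)) = 1 + ENNReal.ofReal (Real.exp s - 1) *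
      {x : unitInterval | (x : ℝ) ≤ g}.indicator 1 x := by
    intro x
    by_cases hx : x ∈ {x : unitInterval | (x : ℝ) ≤ g}
    · rw [Set.indicator_of_mem hx, Set.indicator_of_mem hx, Pi.one_apply, Pi.one_apply, mul_one,
        mul_one, ← ENNReal.ofReal_one, ← ENNReal.ofReal_add zero_le_one hes, add_sub_cancel]
    · rw [Set.indicator_of_notMem hx, Set.indicator_of_notMem hx]
      simp
  have h2 : volume {x : unitInterval | (x : ℝ) ≤ g} ≤ ENNReal.ofReal g := by
    have h3 : {x : unitInterval | (x : ℝ) ≤ g} = {x : unitInterval | (x : ℝ) ∈ Set.Icc 0 g} := by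
      ext x
      exact ⟨fun hx => ⟨x.2.1, hx⟩, fun hx => hx.2⟩
    rw [h3]
    refine (volume_unitInterval_preimage_le _ measurableSet_Icc).trans ?_
    rw [Real.volume_Icc, sub_zero]
  rw [lintegral_congr h1, lintegral_add_left measurable_const,
    lintegral_const_mul _ (measurable_one.indicator hm), lintegral_indicator_one hm]
  simp only [lintegral_const, measure_univ, mul_one]
  calc 1 + ENNReal.ofReal (Real.exp s - 1) * volume {x : unitInterval | (x : ℝ) ≤ g}
      ≤ 1 + ENNReal.ofReal (Real.exp s - 1) * ENNReal.ofReal g := by gcongr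
    _ = ENNReal.ofReal (1 + (Real.exp s - 1) * g) := by
        rw [← ENNReal.ofReal_mul hes, ENNReal.ofReal_add zero_le_one (by positivity),
          ENNReal.ofReal_one]
    _ ≤ _ := ENNReal.ofReal_le_ofReal (by
        rw [add_comm]
        exact Real.add_one_le_exp _)

/-- For fixed `ψ`, the exponential moments of the number of connected points. -/
theorem IsSimple.lintegral_exp_connectedSet_le {ψ : Measure (MarkedPoint d A α)} (h : IsSimple ψ)
    (hα : 1 ≤ α) (z : ℕ ≃ (Fin d → ℤ))
    {φ : (j : ℕ) → (Fin (j + 1) → Space d × A) → ℝ} (hφ : IsConnectionFunction (φ 1))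
    {W : Set (Space d)} (hW : MeasurableSet W) (hWb : Bornology.IsBounded W) (a : A)
    {s : ℝ} (hs : 0 ≤ s) :
    ∫⁻ u, ENNReal.ofReal (Real.exp (s * (ψ (connectedSet hα z φ W ψ a u)).toReal))
      ∂(decisionLaw α) ≤ ENNReal.ofReal (Real.exp ((Real.exp s - 1) *
        (∫⁻ p in {p | p.1 ∈ W}, ENNReal.ofReal (edgeProb φ a p) ∂ψ).toReal)) := by
  classical
  set F := (h.counting.finite_points hWb).toFinset with hF
  set c : MarkedPoint d A α → DecisionIndex α := fun p => edgeIndex hα (coordinatesAux z ψ p)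
    with hc
  have hFp : ∀ p ∈ F, p ∈ points ψ := fun p hp => ((Set.Finite.mem_toFinset _).1 hp).1
  -- Different points read different components of `u`; this is the source of the independence of
  -- the edges.
  have hcinj : Function.Injective fun p : F => c p := by
    intro p q hpq
    have h1 := edgeIndex_injective hα hpq
    rw [h.coordinatesAux_eq, h.coordinatesAux_eq] at h1
    exact Subtype.ext (h.coordinates_injOn z (hFp p p.2) (hFp q q.2) h1)
  have hg0 : ∀ p : MarkedPoint d A α, 0 ≤ edgeProb φ a p := fun p => (hφ.mem_unit _).1
  set I : MarkedPoint d A α → unitInterval → ℝ := fun p =>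
    {x : unitInterval | (x : ℝ) ≤ edgeProb φ a p}.indicator 1 with hI
  have hIm : ∀ p, Measurable (I p) := fun p => measurable_one.indicator
    (measurableSet_le measurable_subtype_coe measurable_const)
  set Y : F → unitInterval → ℝ≥0∞ := fun p x => ENNReal.ofReal (Real.exp (s * I p x)) with hY
  have hYm : ∀ p, Measurable (Y p) := fun p =>
    (Real.measurable_exp.comp (measurable_const.mul (hIm p))).ennreal_ofReal
  have hcount : ∀ u, (ψ (connectedSet hα z φ W ψ a u)).toReal = ∑ p : F, I p (u (c p)) := by
    intro u
    have hm : MeasurableSet (connectedSet hα z φ W ψ a u) :=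
      (measurable_prodMk_left (x := ((⟨ψ, h.counting⟩ : Config d A α), a, u)))
        (measurableSet_connectedSet hα z hφ.measurable hW)
    have h1 : ψ (connectedSet hα z φ W ψ a u) =
        ∑ p ∈ F, (connectedSet hα z φ W ψ a u).indicator 1 p := by
      rw [← h.setLIntegral_eq_sum hW hWb, lintegral_indicator_one hm,
        Measure.restrict_apply hm, Set.inter_eq_left.2 fun p hp => hp.1]
    rw [h1, ENNReal.toReal_sum, ← Finset.sum_coe_sort]
    · refine Finset.sum_congr rfl fun p _ => ?_
      have hpW := ((Set.Finite.mem_toFinset _).1 p.2).2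
      by_cases hp : (u (c p) : ℝ) ≤ edgeProb φ a p.1
      · rw [Set.indicator_of_mem (show p.1 ∈ connectedSet hα z φ W ψ a u from ⟨hpW, hp⟩), hI]
        simp only
        rw [Set.indicator_of_mem (show u (c p) ∈ {x : unitInterval |
          (x : ℝ) ≤ edgeProb φ a p.1} from hp)]
        simp
      · rw [Set.indicator_of_notMem (show p.1 ∉ connectedSet hα z φ W ψ a u from
          fun h' => hp h'.2), hI]
        simp only
        rw [Set.indicator_of_notMem (show u (c p) ∉ {x : unitInterval |
          (x : ℝ) ≤ edgeProb φ a p.1} from hp)]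
        simp
    · intro p _
      by_cases hp : p ∈ connectedSet hα z φ W ψ a u <;> simp [hp]
  have hindep : iIndepFun (fun (p : F) (u : Decision α) => Y p (u (c p))) (decisionLaw α) := by
    have h1 : iIndepFun (fun (i : DecisionIndex α) (u : Decision α) => u i) (decisionLaw α) :=
      iIndepFun_infinitePi (X := fun _ x => x) fun _ => measurable_id
    exact (h1.precomp hcinj).comp Y hYm
  have hmarg : ∀ p : F, ∫⁻ u, Y p (u (c p)) ∂decisionLaw α = ∫⁻ x, Y p x := by
    intro p
    rw [← lintegral_map (hYm p) (measurable_pi_apply (c p)), decisionLaw,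
      Measure.infinitePi_map_eval]
  calc ∫⁻ u, ENNReal.ofReal (Real.exp (s * (ψ (connectedSet hα z φ W ψ a u)).toReal))
        ∂(decisionLaw α) = ∫⁻ u, ∏ p : F, Y p (u (c p)) ∂(decisionLaw α) := by
        refine lintegral_congr fun u => ?_
        rw [hcount, Finset.mul_sum, Real.exp_sum,
          ENNReal.ofReal_prod_of_nonneg fun i _ => (Real.exp_pos _).le]
    _ = ∏ p : F, ∫⁻ u, Y p (u (c p)) ∂(decisionLaw α) :=
        lintegral_prod_eq_prod_lintegral_of_indepFun _ _ hindep
          fun p => (hYm p).comp (measurable_pi_apply _)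
    _ ≤ ∏ p : F, ENNReal.ofReal (Real.exp ((Real.exp s - 1) * edgeProb φ a p.1)) :=
        Finset.prod_le_prod' fun p _ => (hmarg p).trans_le (lintegral_exp_indicator_le hs (hg0 _))
    _ = _ := by
        rw [h.setLIntegral_eq_sum hW hWb, ENNReal.toReal_sum fun _ _ => ENNReal.ofReal_ne_top,
          Finset.mul_sum, Real.exp_sum, ENNReal.ofReal_prod_of_nonneg fun i _ =>
          (Real.exp_pos _).le, ← Finset.prod_coe_sort F]
        refine Finset.prod_congr rfl fun p _ => ?_
        rw [ENNReal.toReal_ofReal (hg0 _)]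

/-- The time and decision marks do not enter the edge probability and integrate to one. -/
theorem setLIntegral_edgeProb_le (γ : ℝ≥0) (Θ : Measure A) [IsProbabilityMeasure Θ]
    {φ : (j : ℕ) → (Fin (j + 1) → Space d × A) → ℝ} (hφ : Measurable (φ 1))
    (W : Set (Space d)) (a : A) :
    ∫⁻ p in {p | p.1 ∈ W}, ENNReal.ofReal (edgeProb φ a p) ∂(intensity d α γ Θ) ≤
      mixingParameter γ Θ φ a := by
  refine (setLIntegral_le_lintegral _ _).trans ?_
  have hm : Measurable fun p : MarkedPoint d A α => ENNReal.ofReal (edgeProb φ a p) :=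
    ((measurable_edgeProb hφ).comp measurable_prodMk_left).ennreal_ofReal
  rw [intensity, lintegral_prod _ hm.aemeasurable, mixingParameter,
    lintegral_smul_measure, ENNReal.smul_def, smul_eq_mul]
  refine mul_le_mul_right (lintegral_mono fun y => ?_) _
  have hm' : Measurable fun r : A × unitInterval × Decision α =>
      ENNReal.ofReal (edgeProb φ a ((y, r) : MarkedPoint d A α)) := hm.comp measurable_prodMk_left
  rw [lintegral_prod _ hm'.aemeasurable]
  refine lintegral_mono fun b => ?_
  have h1 : ∀ r : unitInterval × Decision α,
      edgeProb φ a ((y, b, r) : MarkedPoint d A α) = φ 1 ![((0 : Space d), a), (y, b)] :=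
    fun r => rfl
  simp only [h1]
  rw [lintegral_const, measure_univ, mul_one]

end OriginDegree


/-! ### The third moment of the degree of the added point -/

section Moments

variable {d : ℕ} {A Ω : Type*} {α : ℕ} [MeasurableSpace A] [StandardBorelSpace A]
  [MeasurableSpace Ω] {P : Measure Ω} {Θ : Measure A} [IsProbabilityMeasure Θ] {γ : ℝ≥0}
  {Ψ : Ω → Measure (MarkedPoint d A α)}

/-- This is t³ / 3! ≤ e^t at t = (1 + x) / M, with e^(1/M) ≤ e. -/
theorem one_add_pow_three_le {x M : ℝ} (hx : 0 ≤ x) (hM : 1 ≤ M) :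
    (1 + x) ^ 3 ≤ 6 * Real.exp 1 * M ^ 3 * Real.exp (1 / M * x) := by
  have hM0 : 0 < M := by linarith
  have h1 := Real.pow_div_factorial_le_exp (x := (1 + x) / M) (by positivity) 3
  rw [div_pow, div_div, div_le_iff₀ (by positivity)] at h1
  have h2 : Real.exp ((1 + x) / M) ≤ Real.exp 1 * Real.exp (1 / M * x) := by
    rw [← Real.exp_add]
    refine Real.exp_le_exp.2 ?_
    rw [add_div, one_div_mul_eq_div]
    exact add_le_add_left ((div_le_one hM0).2 hM) _
  refine h1.trans ((mul_le_mul_of_nonneg_right h2 (by positivity)).trans_eq ?_)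
  have h3 : ((Nat.factorial 3 : ℕ) : ℝ) = 6 := by norm_num [Nat.factorial]
  rw [h3]
  ring

/-- The constant in the bound for the third moment. -/
def momentConst : ℝ := 6 * Real.exp 1 * Real.exp (Real.exp (Real.exp 1 - 1) - 1)

theorem momentConst_pos : 0 < momentConst := by
  unfold momentConst
  positivity

/-- Exponential moments are taken at a scale adapted to the mean, first over the decisions and then
over the process. This keeps the growth in π(a) cubic, and the bound does not see `W`. -/
theorem lintegral_connectedSet_pow_le (hd : 1 ≤ d) (hα : 1 ≤ α)
    (hΨ : IsPoissonProcess P Ψ (intensity d α γ Θ)) (z : ℕ ≃ (Fin d → ℤ))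
    {φ : (j : ℕ) → (Fin (j + 1) → Space d × A) → ℝ} (hφ : IsConnectionFunction (φ 1))
    {W : Set (Space d)} (hW : MeasurableSet W) (hWb : Bornology.IsBounded W) (a : A) :
    ∫⁻ ω, ∫⁻ u, ENNReal.ofReal ((1 + (Ψ ω (connectedSet hα z φ W (Ψ ω) a u)).toReal) ^ 3)
      ∂(decisionLaw α) ∂P ≤
      ENNReal.ofReal momentConst * (1 + mixingParameter γ Θ φ a ^ 3) := by
  by_cases htop : mixingParameter γ Θ φ a = ∞
  · rw [htop, ENNReal.top_pow (by norm_num), add_top,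
      ENNReal.mul_top (ENNReal.ofReal_pos.2 momentConst_pos).ne']
    exact le_top
  set r := (mixingParameter γ Θ φ a).toReal with hr
  have hr0 : 0 ≤ r := ENNReal.toReal_nonneg
  -- With `s = 1 / M` both `s ≤ 1` and `s * r ≤ 1` hold. Two uses of the chord bound then make the
  -- exponent at most exp(e - 1) - 1.
  set M := max 1 r with hM
  have hM1 : 1 ≤ M := le_max_left _ _
  have hM0 : 0 < M := by linarith
  set s := 1 / M with hs
  have hs0 : 0 ≤ s := by positivity
  have hs1 : s ≤ 1 := (div_le_one hM0).2 hM1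
  set K := 6 * Real.exp 1 * M ^ 3 with hK
  have hK0 : 0 ≤ K := by positivity
  set c := Real.exp s - 1 with hc
  have hc0 : 0 ≤ c := sub_nonneg.2 (Real.one_le_exp hs0)
  have hWfin : volume W ≠ ∞ := hWb.measure_lt_top.ne
  have hμ : intensity d α γ Θ {p | p.1 ∈ W} ≠ ∞ := by
    rw [intensity_fst]
    exact ENNReal.mul_ne_top ENNReal.coe_ne_top hWfin
  have hexp : (Real.exp c - 1) * (∫⁻ p in {p | p.1 ∈ W}, ENNReal.ofReal (edgeProb φ a p)
      ∂(intensity d α γ Θ)).toReal ≤ Real.exp (Real.exp 1 - 1) - 1 := by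
    have h1 : c ≤ (Real.exp 1 - 1) * s := by
      have := exp_mul_sub_one_le hs0 hs1 1
      rw [one_mul] at this
      linarith
    have h2 : Real.exp c - 1 ≤ s * (Real.exp (Real.exp 1 - 1) - 1) :=
      (sub_le_sub_right (Real.exp_le_exp.2 h1) 1).trans (exp_mul_sub_one_le hs0 hs1 _)
    have h3 := ENNReal.toReal_mono htop (setLIntegral_edgeProb_le (α := α) γ Θ hφ.measurable W a)
    have hB : 0 ≤ Real.exp (Real.exp 1 - 1) - 1 := sub_nonneg.2
      (Real.one_le_exp (sub_nonneg.2 (Real.one_le_exp zero_le_one)))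
    have hsr : s * r ≤ 1 := by
      rw [hs, one_div_mul_eq_div, div_le_one hM0]
      exact le_max_right _ _
    calc _ ≤ s * (Real.exp (Real.exp 1 - 1) - 1) * r :=
          mul_le_mul h2 h3 ENNReal.toReal_nonneg (by positivity)
      _ = s * r * (Real.exp (Real.exp 1 - 1) - 1) := by ring
      _ ≤ _ := mul_le_of_le_one_left hB hsr
  calc ∫⁻ ω, ∫⁻ u, ENNReal.ofReal ((1 + (Ψ ω (connectedSet hα z φ W (Ψ ω) a u)).toReal) ^ 3)
      ∂(decisionLaw α) ∂P
      ≤ ∫⁻ ω, ENNReal.ofReal K * ENNReal.ofReal (Real.exp (c *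
        (∫⁻ p in {p | p.1 ∈ W}, ENNReal.ofReal (edgeProb φ a p) ∂Ψ ω).toReal)) ∂P := by
        refine lintegral_mono_ae ?_
        filter_upwards [ae_isSimple hd hΨ] with ω hω
        refine le_trans ?_ (mul_le_mul_right
          (hω.lintegral_exp_connectedSet_le hα z hφ hW hWb a hs0) (ENNReal.ofReal K))
        rw [← lintegral_const_mul' _ _ ENNReal.ofReal_ne_top]
        refine lintegral_mono fun u => ?_
        rw [← ENNReal.ofReal_mul hK0]
        exact ENNReal.ofReal_le_ofReal (one_add_pow_three_le ENNReal.toReal_nonneg hM1)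
    _ ≤ ENNReal.ofReal K * ENNReal.ofReal (Real.exp (Real.exp (Real.exp 1 - 1) - 1)) := by
        rw [lintegral_const_mul' _ _ ENNReal.ofReal_ne_top]
        refine mul_le_mul_right ?_ _
        refine (hΨ.lintegral_exp_le (measurableSet_fst_preimage hW) hμ
          (fun ω => ((hΨ.locallyFiniteCounting ω).lt_top hWb).ne)
          ((measurable_edgeProb hφ.measurable).comp measurable_prodMk_left)
          (fun p => (hφ.mem_unit _).1) (fun p => (hφ.mem_unit _).2) hc0).trans ?_
        exact ENNReal.ofReal_le_ofReal (Real.exp_le_exp.2 hexp)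
    _ = ENNReal.ofReal momentConst * ENNReal.ofReal (M ^ 3) := by
        rw [← ENNReal.ofReal_mul hK0, ← ENNReal.ofReal_mul momentConst_pos.le, momentConst, hK]
        congr 1
        ring
    _ ≤ _ := by
        refine mul_le_mul_right ?_ _
        have h1 : M ^ 3 ≤ 1 + r ^ 3 := by
          rcases max_cases 1 r with h | h
          · rw [hM, h.1]
            have := pow_nonneg hr0 3
            linarith
          · rw [hM, h.1]
            linarith
        refine (ENNReal.ofReal_le_ofReal h1).trans_eq ?_
        rw [ENNReal.ofReal_add zero_le_one (by positivity), ENNReal.ofReal_one,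
          ENNReal.ofReal_pow hr0, hr, ENNReal.ofReal_toReal htop]

/-- The Poisson process as a random element of the space of locally finite counting measures. -/
def IsPoissonProcess.config {μ : Measure (MarkedPoint d A α)} (hΨ : IsPoissonProcess P Ψ μ)
    (ω : Ω) : Config d A α :=
  ⟨Ψ ω, hΨ.locallyFiniteCounting ω⟩

theorem IsPoissonProcess.measurable_config {μ : Measure (MarkedPoint d A α)}
    (hΨ : IsPoissonProcess P Ψ μ) : Measurable hΨ.config :=
  hΨ.measurable.subtype_mk

variable [IsProbabilityMeasure P]

/-- The integral over the mark is placed outermost, because the moment bound is available for each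
fixed mark. -/
theorem lintegral_config {μ : Measure (MarkedPoint d A α)}
    (hΨ : IsPoissonProcess P Ψ μ) {V : Ω → A} (hV : Measurable V) (hVlaw : P.map V = Θ)
    {U : Ω → Decision α} (hU : Measurable U) (hUlaw : P.map U = decisionLaw α)
    (hVU : IndepFun V U P) (hΨVU : IndepFun Ψ (fun ω => (V ω, U ω)) P)
    {f : Config d A α × A × Decision α → ℝ≥0∞} (hf : Measurable f) :
    ∫⁻ ω, f (hΨ.config ω, V ω, U ω) ∂P =
      ∫⁻ a, ∫⁻ ω, ∫⁻ u, f (hΨ.config ω, a, u) ∂(decisionLaw α) ∂P ∂Θ := by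
  have hc := hΨ.measurable_config
  have hind : IndepFun hΨ.config (fun ω => (V ω, U ω)) P := by
    rw [IndepFun_iff_Indep] at hΨVU ⊢
    convert hΨVU using 1
    exact MeasurableSpace.comap_comp
  have hlaw : P.map (fun ω => (hΨ.config ω, V ω, U ω)) =
      (P.map hΨ.config).prod (Θ.prod (decisionLaw α)) := by
    rw [(indepFun_iff_map_prod_eq_prod_map_map hc.aemeasurable
      (hV.prodMk hU).aemeasurable).1 hind, (indepFun_iff_map_prod_eq_prod_map_map
      hV.aemeasurable hU.aemeasurable).1 hVU, hVlaw, hUlaw]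
  have : IsProbabilityMeasure (P.map hΨ.config) := Measure.isProbabilityMeasure_map hc.aemeasurable
  rw [← lintegral_map (μ := P) hf (hc.prodMk (hV.prodMk hU)), hlaw,
    lintegral_prod _ hf.aemeasurable]
  have hf1 : ∀ ψ, Measurable fun x : A × Decision α => f (ψ, x) := fun ψ =>
    hf.comp measurable_prodMk_left
  have hf2 : Measurable fun x : Config d A α × A => ∫⁻ u, f (x.1, x.2, u) ∂(decisionLaw α) :=
    Measurable.lintegral_prod_right' (f := fun y : (Config d A α × A) × Decision α =>
      f (y.1.1, y.1.2, y.2)) (hf.comp (by fun_prop))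
  calc ∫⁻ ψ, ∫⁻ x, f (ψ, x) ∂(Θ.prod (decisionLaw α)) ∂(P.map hΨ.config)
      = ∫⁻ ψ, ∫⁻ a, ∫⁻ u, f (ψ, a, u) ∂(decisionLaw α) ∂Θ ∂(P.map hΨ.config) :=
        lintegral_congr fun ψ => lintegral_prod _ (hf1 ψ).aemeasurable
    _ = ∫⁻ a, ∫⁻ ψ, ∫⁻ u, f (ψ, a, u) ∂(decisionLaw α) ∂(P.map hΨ.config) ∂Θ :=
        lintegral_lintegral_swap hf2.aemeasurable
    _ = _ := lintegral_congr fun a => lintegral_map (hf2.comp measurable_prodMk_right) hc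

/-- The third moments of the number of points connected with the added point are bounded. -/
theorem exists_lintegral_connectedSet_le (hd : 1 ≤ d) (hα : 1 ≤ α)
    (hΨ : IsPoissonProcess P Ψ (intensity d α γ Θ)) (z : ℕ ≃ (Fin d → ℤ))
    {φ : (j : ℕ) → (Fin (j + 1) → Space d × A) → ℝ} (hφ : IsConnectionFunction (φ 1))
    {V : Ω → A} (hV : Measurable V) (hVlaw : P.map V = Θ)
    {U : Ω → Decision α} (hU : Measurable U) (hUlaw : P.map U = decisionLaw α)
    (hVU : IndepFun V U P) (hΨVU : IndepFun Ψ (fun ω => (V ω, U ω)) P)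
    (hπ : ∫⁻ ω, mixingParameter γ Θ φ (V ω) ^ 3 ∂P < ∞) :
    ∃ C : ℝ≥0∞, C < ∞ ∧ ∀ W : Set (Space d), MeasurableSet W → Bornology.IsBounded W →
      ∫⁻ ω, ENNReal.ofReal
        ((1 + (Ψ ω (connectedSet hα z φ W (Ψ ω) (V ω) (U ω))).toReal) ^ 3) ∂P ≤ C := by
  refine ⟨ENNReal.ofReal momentConst * (1 + ∫⁻ a, mixingParameter γ Θ φ a ^ 3 ∂Θ),
    ENNReal.mul_lt_top ENNReal.ofReal_lt_top (ENNReal.add_lt_top.2 ⟨ENNReal.one_lt_top, ?_⟩),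
    fun W hW hWb => ?_⟩
  · rw [← hVlaw]
    -- Only this inequality is needed, so measurability of `mixingParameter` in the mark plays no
    -- role.
    refine (lintegral_map_le _ _).trans_lt ?_
    rwa [hVlaw]
  · have hm : Measurable fun x : Config d A α × A × Decision α => ENNReal.ofReal
        ((1 + (x.1.1 (connectedSet hα z φ W x.1.1 x.2.1 x.2.2)).toReal) ^ 3) :=
      ((measurable_const.add (measurable_measure_connectedSet hα z hφ.measurable
        hW).ennreal_toReal).pow_const 3).ennreal_ofReal
    refine (lintegral_config hΨ hV hVlaw hU hUlaw hVU hΨVU hm).trans_le ?_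
    refine (lintegral_mono fun a =>
      lintegral_connectedSet_pow_le hd hα hΨ z hφ hW hWb a).trans_eq ?_
    rw [lintegral_const_mul' _ _ ENNReal.ofReal_ne_top, lintegral_add_left measurable_const,
      lintegral_const, measure_univ, mul_one]

end Moments


/-! ### The difference operator at the origin -/

section Cubes

variable {d : ℕ}

theorem IsCube.measurableSet {W : Set (Space d)} (hW : IsCube W) : MeasurableSet W := by
  obtain ⟨c, s, -, rfl⟩ := hW
  have hi : ∀ i, Measurable fun x : Space d => x i := fun i =>
    (EuclideanSpace.proj (𝕜 := ℝ) i).continuous.measurable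
  simp only [Set.ofPred_forall]
  exact MeasurableSet.iInter fun i => (measurableSet_le measurable_const (hi i)).inter
    (measurableSet_lt (hi i) measurable_const)

theorem IsCube.isBounded {W : Set (Space d)} (hW : IsCube W) : Bornology.IsBounded W := by
  obtain ⟨c, s, hs, rfl⟩ := hW
  refine isBounded_of_forall_abs_le (fun i => |c i| + s) fun x hx i => ?_
  have h1 := hx i
  have h2 := neg_abs_le (c i)
  have h3 := le_abs_self (c i)
  rw [abs_le]
  constructor <;> linarith

/-- The cubes `[-(n + 1), n + 1)ᵈ`. -/
def centeredCube (d n : ℕ) : Set (Space d) :=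
  {x | ∀ i, -((n : ℝ) + 1) ≤ x i ∧ x i < -((n : ℝ) + 1) + 2 * (n + 1)}

theorem isCube_centeredCube (n : ℕ) : IsCube (centeredCube d n) :=
  ⟨fun _ => -((n : ℝ) + 1), 2 * (n + 1), by positivity, rfl⟩

theorem tendsToSpace_centeredCube : TendsToSpace (centeredCube d) := by
  intro B hB
  obtain ⟨r, hr⟩ := isBounded_iff_forall_norm_le.1 hB
  obtain ⟨N, hN⟩ := exists_nat_gt r
  refine ⟨N, fun n hn x hx i => ?_⟩
  have h1 := abs_le.1 ((PiLp.norm_apply_le x i).trans (hr x hx))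
  have h2 : (N : ℝ) ≤ n := by exact_mod_cast hn
  constructor <;> linarith [h1.1, h1.2]

end Cubes

/-! ### Bound, measurability and limit of the difference at the origin -/

section Origin

variable {d : ℕ} {A Ω : Type*} {α : ℕ} [MeasurableSpace A] [StandardBorelSpace A]
  [MeasurableSpace Ω]

theorem IsSimple.eq_of_mem_vertices {ψ : Measure (MarkedPoint d A α)} (h : IsSimple ψ)
    (z : ℕ ≃ (Fin d → ℤ)) (φ : (j : ℕ) → (Fin (j + 1) → Space d × A) → ℝ)
    {p : MarkedPoint d A α} (hp : p ∈ points ψ) {v : Space d × A}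
    (hv : v ∈ vertices (complex z φ ψ)) (hvp : v.1 = p.vertex.1) : v = p.vertex := by
  obtain ⟨q, hq, rfl⟩ := (mem_faces_complex.1 hv).2.2.1 v (Finset.mem_singleton_self v)
  rw [h.fst_inj hq hp hvp]

theorem IsAddable.abs_diffOp_le (hα : 1 ≤ α) (z : ℕ ≃ (Fin d → ℤ))
    {φ : (j : ℕ) → (Fin (j + 1) → Space d × A) → ℝ} (hφ : IsConnectionFunction (φ 1))
    {ψ : Measure (MarkedPoint d A α)} {a : A} {u : Decision α}
    (h : IsAddable ψ ((0 : Space d), a, (1 : unitInterval), u))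
    {W : Set (Space d)} (hW : MeasurableSet W) (hWb : Bornology.IsBounded W) (m l : ℕ) :
    |diffOp z φ (numVerticesOfDegree m l) W ((0 : Space d), a, (1 : unitInterval), u) ψ| ≤
      1 + (ψ (connectedSet hα z φ W ψ a u)).toReal := by
  set o : MarkedPoint d A α := ((0 : Space d), a, (1 : unitInterval), u) with ho
  have hs := h.add_dirac
  have hop : o ∈ points (ψ + Measure.dirac o) := by
    rw [points_add_dirac]
    exact Set.mem_insert _ _
  refine (abs_numVertices_sub_le (o := o.vertex)
    (fun v hv hvo => hs.eq_of_mem_vertices z φ hop hv hvo)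
    (hs.finite_vertices z φ hWb) m l).trans (add_le_add_right ?_ 1)
  have hfin : {p | p ∈ points ψ ∧ p ∈ connectedSet hα z φ W ψ a u}.Finite :=
    (h.simple.counting.finite_points hWb).subset fun p hp => ⟨hp.1, hp.2.1⟩
  have hsub : {v | v ∈ neighbors (complex z φ (ψ + Measure.dirac o)) o.vertex ∧ v.1 ∈ W} ⊆
      MarkedPoint.vertex '' {p | p ∈ points ψ ∧ p ∈ connectedSet hα z φ W ψ a u} := by
    rintro v ⟨hv, hvW⟩
    obtain ⟨p, ⟨hp, -, hpc⟩, rfl⟩ := h.neighbors_subset hα z hφ hv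
    exact ⟨p, ⟨hp, hvW, hpc⟩, rfl⟩
  have hm : MeasurableSet (connectedSet hα z φ W ψ a u) :=
    (measurable_prodMk_left (x := ((⟨ψ, h.simple.counting⟩ : Config d A α), a, u)))
      (measurableSet_connectedSet hα z hφ.measurable hW)
  rw [h.simple.counting.measure_eq_encard h.simple.le_one hm, ← hfin.cast_ncard_eq]
  have h1 := (Set.ncard_le_ncard hsub (hfin.image _)).trans (Set.ncard_image_le hfin)
  simpa using h1

theorem IsAddable.exists_diffOp_stable (hα : 1 ≤ α) (z : ℕ ≃ (Fin d → ℤ))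
    {φ : (j : ℕ) → (Fin (j + 1) → Space d × A) → ℝ} (hφ : IsConnectionFunction (φ 1))
    {ψ : Measure (MarkedPoint d A α)} {a : A} {u : Decision α}
    (h : IsAddable ψ ((0 : Space d), a, (1 : unitInterval), u))
    (hfin : ψ (connectedSet hα z φ Set.univ ψ a u) < ∞) (m l : ℕ) :
    ∃ C : Set (Space d), Bornology.IsBounded C ∧ ∃ c : ℝ, ∀ W, Bornology.IsBounded W → C ⊆ W →
      diffOp z φ (numVerticesOfDegree m l) W ((0 : Space d), a, (1 : unitInterval), u) ψ = c := by
  set o : MarkedPoint d A α := ((0 : Space d), a, (1 : unitInterval), u) with ho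
  have hs := h.add_dirac
  have hop : o ∈ points (ψ + Measure.dirac o) := by
    rw [points_add_dirac]
    exact Set.mem_insert _ _
  exact exists_numVertices_sub_stable (o := o.vertex)
    (fun v hv hvo => hs.eq_of_mem_vertices z φ hop hv hvo)
    (fun W hWb => hs.finite_vertices z φ hWb) m l
    (((h.simple.counting.finite_of_lt_top hfin).image _).subset (h.neighbors_subset hα z hφ))

variable {P : Measure Ω} {Θ : Measure A} [IsProbabilityMeasure Θ] {γ : ℝ≥0}
  {Ψ : Ω → Measure (MarkedPoint d A α)} {V : Ω → A} {U : Ω → Decision α}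

/-- The measurable version replaces both counts by `numVerticesAux` of the enlarged configuration;
the two agree whenever that configuration is simple. -/
theorem aemeasurable_originDiffOp (hd : 1 ≤ d)
    (hΨ : IsPoissonProcess P Ψ (intensity d α γ Θ)) (z : ℕ ≃ (Fin d → ℤ))
    {φ : (j : ℕ) → (Fin (j + 1) → Space d × A) → ℝ}
    (hφ : ∀ j, 1 ≤ j → j ≤ α → Measurable (φ j)) (hV : Measurable V) (hU : Measurable U)
    {W : Set (Space d)} (hW : MeasurableSet W) (hWb : Bornology.IsBounded W) (m l : ℕ) :
    AEMeasurable (originDiffOp z φ Ψ V U (numVerticesOfDegree m l) W) P := by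
  have hc : Measurable fun ω => (⟨Ψ ω + Measure.dirac ((0 : Space d), V ω, (1 : unitInterval), U ω),
      (hΨ.locallyFiniteCounting ω).add_dirac _⟩ : Config d A α) :=
    measurable_add_dirac.comp (hΨ.measurable_config.prodMk
      (measurable_const.prodMk (hV.prodMk (measurable_const.prodMk hU))))
  have hW' : MeasurableSet (W \ {(0 : Space d)}) := hW.diff (measurableSet_singleton _)
  refine ⟨fun ω => numVerticesAux z φ W m l
      (Ψ ω + Measure.dirac ((0 : Space d), V ω, (1 : unitInterval), U ω)) -
    numVerticesAux z φ (W \ {0}) m l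
      (Ψ ω + Measure.dirac ((0 : Space d), V ω, (1 : unitInterval), U ω)),
    ((measurable_numVerticesAux z hφ hW m l).comp hc).sub
      ((measurable_numVerticesAux z hφ hW' m l).comp hc), ?_⟩
  filter_upwards [ae_isAddable hd hΨ] with ω hω
  have hs := (hω (V ω) (U ω)).add_dirac
  rw [originDiffOp, diffOp, hs.numVertices_eq z hφ hW hWb, hs.numVertices_eq z hφ hW'
    (hWb.subset Set.sdiff_subset)]

variable [IsProbabilityMeasure P]

/-- The moment bound is uniform over balls, so by monotone convergence the total number of connected
points has finite mean. -/
theorem ae_connectedSet_lt_top (hd : 1 ≤ d) (hα : 1 ≤ α)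
    (hΨ : IsPoissonProcess P Ψ (intensity d α γ Θ)) (z : ℕ ≃ (Fin d → ℤ))
    {φ : (j : ℕ) → (Fin (j + 1) → Space d × A) → ℝ} (hφ : IsConnectionFunction (φ 1))
    (hV : Measurable V) (hVlaw : P.map V = Θ)
    (hU : Measurable U) (hUlaw : P.map U = decisionLaw α)
    (hVU : IndepFun V U P) (hΨVU : IndepFun Ψ (fun ω => (V ω, U ω)) P)
    (hπ : ∫⁻ ω, mixingParameter γ Θ φ (V ω) ^ 3 ∂P < ∞) :
    ∀ᵐ ω ∂P, Ψ ω (connectedSet hα z φ Set.univ (Ψ ω) (V ω) (U ω)) < ∞ := by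
  obtain ⟨C, hC, hbound⟩ := exists_lintegral_connectedSet_le hd hα hΨ z hφ hV hVlaw hU hUlaw hVU
    hΨVU hπ
  set D : ℕ → Ω → ℝ≥0∞ := fun n ω =>
    Ψ ω (connectedSet hα z φ (Metric.ball 0 n) (Ψ ω) (V ω) (U ω)) with hD
  have hDm : ∀ n, Measurable (D n) := fun n =>
    (measurable_measure_connectedSet hα z hφ.measurable Metric.isOpen_ball.measurableSet).comp
      (hΨ.measurable_config.prodMk (hV.prodMk hU))
  have hmono : ∀ ω, Monotone fun n : ℕ =>
      connectedSet hα z φ (Metric.ball 0 n) (Ψ ω) (V ω) (U ω) := fun ω n k hnk p hp =>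
    ⟨Metric.ball_subset_ball (by exact_mod_cast hnk) hp.1, hp.2⟩
  have hsup : ∀ ω, Ψ ω (connectedSet hα z φ Set.univ (Ψ ω) (V ω) (U ω)) = ⨆ n, D n ω := by
    intro ω
    rw [hD, ← (hmono ω).measure_iUnion]
    congr 1
    ext p
    rw [Set.mem_iUnion]
    constructor
    · rintro ⟨-, hp⟩
      obtain ⟨n, hn⟩ := exists_nat_gt ‖p.1‖
      exact ⟨n, by simpa using hn, hp⟩
    · rintro ⟨n, -, hp⟩
      exact ⟨trivial, hp⟩
  have hint : ∀ n, ∫⁻ ω, D n ω ∂P ≤ C := by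
    intro n
    refine le_trans (lintegral_mono fun ω => ?_)
      (hbound (Metric.ball 0 n) Metric.isOpen_ball.measurableSet Metric.isBounded_ball)
    have hfin : D n ω ≠ ∞ := ne_top_of_le_ne_top
      ((hΨ.locallyFiniteCounting ω).lt_top Metric.isBounded_ball).ne
      (measure_mono fun p hp => hp.1)
    rw [← ENNReal.ofReal_toReal hfin]
    refine ENNReal.ofReal_le_ofReal ?_
    have hx : 0 ≤ (D n ω).toReal := ENNReal.toReal_nonneg
    change (D n ω).toReal ≤ (1 + (D n ω).toReal) ^ 3
    nlinarith [pow_nonneg hx 2, pow_nonneg hx 3]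
  have htotal : ∫⁻ ω, ⨆ n, D n ω ∂P ≠ ∞ := by
    rw [lintegral_iSup hDm fun n k hnk ω => measure_mono (hmono ω hnk)]
    exact ((iSup_le hint).trans_lt hC).ne
  filter_upwards [ae_lt_top (Measurable.iSup hDm) htotal] with ω hω
  rw [hsup ω]
  exact hω

theorem isWeaklyStabilizing_numVerticesOfDegree (hd : 1 ≤ d) (hα : 1 ≤ α)
    (hΨ : IsPoissonProcess P Ψ (intensity d α γ Θ)) (z : ℕ ≃ (Fin d → ℤ))
    {φ : (j : ℕ) → (Fin (j + 1) → Space d × A) → ℝ}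
    (hφ : ∀ j, 1 ≤ j → j ≤ α → IsConnectionFunction (φ j))
    (hV : Measurable V) (hVlaw : P.map V = Θ)
    (hU : Measurable U) (hUlaw : P.map U = decisionLaw α)
    (hVU : IndepFun V U P) (hΨVU : IndepFun Ψ (fun ω => (V ω, U ω)) P)
    (hπ : ∫⁻ ω, mixingParameter γ Θ φ (V ω) ^ 3 ∂P < ∞) (m l : ℕ) :
    IsWeaklyStabilizing P z φ Ψ V U (numVerticesOfDegree m l) := by
  have hmeas : ∀ W : Set (Space d), IsCube W →
      AEMeasurable (originDiffOp z φ Ψ V U (numVerticesOfDegree m l) W) P := fun W hW =>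
    aemeasurable_originDiffOp hd hΨ z (fun j h1 h2 => (hφ j h1 h2).measurable) hV hU
      hW.measurableSet hW.isBounded m l
  have hstable : ∀ᵐ ω ∂P, ∃ c : ℝ, ∀ W : ℕ → Set (Space d), (∀ n, IsCube (W n)) →
      TendsToSpace W → Tendsto (fun n => originDiffOp z φ Ψ V U (numVerticesOfDegree m l) (W n) ω)
        atTop (𝓝 c) := by
    filter_upwards [ae_isAddable hd hΨ, ae_connectedSet_lt_top hd hα hΨ z (hφ 1 le_rfl hα) hV hVlaw
      hU hUlaw hVU hΨVU hπ] with ω h1 h2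
    obtain ⟨C, hC, c, hc⟩ := (h1 (V ω) (U ω)).exists_diffOp_stable hα z (hφ 1 le_rfl hα) h2 m l
    refine ⟨c, fun W hW hWs => tendsto_const_nhds.congr' ?_⟩
    obtain ⟨N, hN⟩ := hWs C hC
    filter_upwards [eventually_ge_atTop N] with n hn
    exact (hc (W n) (hW n).isBounded (hN n hn)).symm
  -- The constant `c` is chosen separately for each `ω` and need not be measurable. Centered cubes
  -- supply a measurable limit, and uniqueness of limits identifies it with `c`.
  obtain ⟨Z, hZ, hZlim⟩ := measurable_limit_of_tendsto_metrizable_ae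
    (fun n => hmeas (centeredCube d n) (isCube_centeredCube n))
    (hstable.mono fun ω ⟨c, hc⟩ => ⟨c, hc _ isCube_centeredCube tendsToSpace_centeredCube⟩)
  refine ⟨isTranslationInvariant_numVerticesOfDegree d A m l, hmeas, Z, hZ, fun W hW hWs => ?_⟩
  refine tendstoInMeasure_of_tendsto_ae (fun n => (hmeas (W n) (hW n)).aestronglyMeasurable) ?_
  filter_upwards [hstable, hZlim] with ω ⟨c, hc⟩ hZω
  rw [tendsto_nhds_unique hZω (hc _ isCube_centeredCube tendsToSpace_centeredCube)]
  exact hc W hW hWs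

theorem momentCondition_numVerticesOfDegree (hd : 1 ≤ d) (hα : 1 ≤ α)
    (hΨ : IsPoissonProcess P Ψ (intensity d α γ Θ)) (z : ℕ ≃ (Fin d → ℤ))
    {φ : (j : ℕ) → (Fin (j + 1) → Space d × A) → ℝ}
    (hφ : ∀ j, 1 ≤ j → j ≤ α → IsConnectionFunction (φ j))
    (hV : Measurable V) (hVlaw : P.map V = Θ)
    (hU : Measurable U) (hUlaw : P.map U = decisionLaw α)
    (hVU : IndepFun V U P) (hΨVU : IndepFun Ψ (fun ω => (V ω, U ω)) P)
    (hπ : ∫⁻ ω, mixingParameter γ Θ φ (V ω) ^ 3 ∂P < ∞) (m l : ℕ) :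
    MomentCondition P z φ Ψ V U (numVerticesOfDegree m l) := by
  obtain ⟨C, hC, hbound⟩ := exists_lintegral_connectedSet_le hd hα hΨ z (hφ 1 le_rfl hα) hV hVlaw
    hU hUlaw hVU hΨVU hπ
  refine ⟨fun W hW _ => aemeasurable_originDiffOp hd hΨ z (fun j h1 h2 => (hφ j h1 h2).measurable)
    -- Taking ε = 1 turns the exponent into three, matching the third moment assumed for π(V).
    hV hU hW.measurableSet hW.isBounded m l, 1, one_pos, ?_⟩
  refine lt_of_le_of_lt (iSup_le fun W => iSup_le fun hW => iSup_le fun _ => ?_) hC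
  refine le_trans (lintegral_mono_ae ?_) (hbound W hW.measurableSet hW.isBounded)
  filter_upwards [ae_isAddable hd hΨ] with ω hω
  have h1 := (hω (V ω) (U ω)).abs_diffOp_le hα z (hφ 1 le_rfl hα) hW.measurableSet hW.isBounded m l
  have h2 : (2 + 1 : ℝ) = ((3 : ℕ) : ℝ) := by norm_num
  rw [h2, ENNReal.rpow_natCast, Real.enorm_eq_ofReal_abs, ← ENNReal.ofReal_pow (abs_nonneg _)]
  exact ENNReal.ofReal_le_ofReal (pow_le_pow_left₀ (abs_nonneg _) h1 3)

end Origin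

end RCM

end

theorem mainTheorem10
    {A Ω : Type*} [MeasurableSpace A] [StandardBorelSpace A] [MeasurableSpace Ω]
    (P : Measure Ω) [IsProbabilityMeasure P] (Θ : Measure A) [IsProbabilityMeasure Θ]
    (d α : ℕ) (hd : 1 ≤ d) (hα : 1 ≤ α) (γ : ℝ≥0) (hγ : 0 < γ)
    (z : ℕ ≃ (Fin d → ℤ)) (hz : z 0 = 0)
    (φ : (j : ℕ) → (Fin (j + 1) → RCM.Space d × A) → ℝ)
    (hφ : ∀ j, 1 ≤ j → j ≤ α → RCM.IsConnectionFunction (φ j))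
    (Ψ : Ω → Measure (RCM.MarkedPoint d A α))
    (hΨ : RCM.IsPoissonProcess P Ψ (RCM.intensity d α γ Θ))
    (V : Ω → A) (hV : Measurable V) (hVlaw : P.map V = Θ)
    (U : Ω → RCM.Decision α) (hU : Measurable U) (hUlaw : P.map U = RCM.decisionLaw α)
    (hVU : IndepFun V U P) (hΨVU : IndepFun Ψ (fun ω => (V ω, U ω)) P)
    (m l : ℕ) (hm : 1 ≤ m)
    (hπ : ∫⁻ ω, RCM.mixingParameter γ Θ φ (V ω) ^ 3 ∂P < ∞) :
    RCM.IsWeaklyStabilizing P z φ Ψ V U (RCM.numVerticesOfDegree m l) ∧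
      RCM.MomentCondition P z φ Ψ V U (RCM.numVerticesOfDegree m l) :=
  ⟨RCM.isWeaklyStabilizing_numVerticesOfDegree hd hα hΨ z hφ hV hVlaw hU hUlaw hVU hΨVU hπ m l,
    RCM.momentCondition_numVerticesOfDegree hd hα hΨ z hφ hV hVlaw hU hUlaw hVU hΨVU hπ m l⟩
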